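/- Let $\mathcal O$ be a complete discrete valuation ring with finite residue field $k$ of cardinality $q$ and fraction field $K$. Let $K'/K$ be a finite unramified extension, with ring of integers $\mathcal O'$ and residue field $k'$ of cardinality $q^r$. Fix uniformizers $\pi\in\mathcal O$ and $\varpi\in\mathcal O'$. Let $\mathbb W_{\mathcal O}=\mathrm{Spec}\,\mathcal O[X_0,X_1,\dots]$ be the ring scheme of ramified Witt vectors over $\mathcal O$: for every $\mathcal O$-algebra $B$, $\mathbb W_{\mathcal O}(B)=B^{\mathbb N}$ as a set, and the ring structure is the unique one, functorial in $B$, for which all the Witt polynomials $$\Phi_n=X_0^{q^n}+\pi X_1^{q^{n-1}}+\dots+\pi^nX_n\qquad(n\ge 0)$$ define ring homomorphisms $\mathbb W_{\mathcal O}(B)\to B$. Let $\mathbb W_{\mathcal O'}$ be defined in the same way from $\varpi$ and the polynomials $\Phi'_n=X_0^{q^{rn}}+\varpi X_1^{q^{r(n-1)}}+\dots+\varpi^nX_n$. Let $u\colon \mathbb W_{\mathcal O}\times_{\mathcal O}\mathrm{Spec}\,\mathcal O'\to\mathbb W_{\mathcal O'}$ be Drinfeld's morphism, i.e. the unique morphism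 of schemes over $\mathrm{Spec}\,\mathcal O'$ (automatically a morphism of ring schemes) such that $\Phi'_n\circ u=\Phi_{rn}$ for all $n\ge 0$, and let $$u_{k'}\colon \mathbb W_{\mathcal O}\times_{\mathcal O}\mathrm{Spec}\,k'\to\mathbb W_{\mathcal O'}\times_{\mathcal O'}\mathrm{Spec}\,k'$$ be its restriction to the special fibers. Then $u_{k'}$ is a universal homeomorphism. Its kernel, as a morphism of (additive) group schemes over $k'$, is pro-infinitesimal, that is, a cofiltered limit of infinitesimal group schemes over $k'$ (finite group schemes over $k'$ with only one point), and as a $k'$-scheme it is isomorphic to $$\mathrm{Spec}\Bigl(k'[X_0,X_1,\dots]\big/\bigl(X_i^{q^{i(r-1)}}\;:\;i\ge 0\bigr)\Bigr).$$ -/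

import Mathlib

universe u v

noncomputable section

set_option linter.unusedSectionVars false

namespace RamifiedWitt

/-! ### Witt polynomials and the integrality lemma -/

section Ghost

variable {B : Type*} [CommRing B]

/-- The value `b₀^(Q^n) + ϖ b₁^(Q^(n-1)) + ⋯ + ϖ^n bₙ` of the `n`-th Witt polynomial. -/
def ghost (ϖ : B) (Q n : ℕ) (b : ℕ → B) : B :=
  ∑ i ∈ Finset.range (n + 1), ϖ ^ i * b i ^ Q ^ (n - i)

lemma ghost_zero (ϖ : B) (Q : ℕ) (b : ℕ → B) : ghost ϖ Q 0 b = b 0 := by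
  simp [ghost]

lemma ghost_succ (ϖ : B) (Q n : ℕ) (b : ℕ → B) :
    ghost ϖ Q (n + 1) b = ghost ϖ Q n (fun i ↦ b i ^ Q) + ϖ ^ (n + 1) * b (n + 1) := by
  unfold ghost
  rw [Finset.sum_range_succ]
  congr 1
  · refine Finset.sum_congr rfl fun i hi ↦ ?_
    have : n + 1 - i = (n - i) + 1 := by
      have := Finset.mem_range.1 hi
      omega
    rw [this, pow_succ' Q, pow_mul]
  · simp

lemma map_ghost {B' : Type*} [CommRing B'] (f : B →+* B') (ϖ : B) (Q n : ℕ) (b : ℕ → B) :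
    f (ghost ϖ Q n b) = ghost (f ϖ) Q n (fun i ↦ f (b i)) := by
  simp [ghost]

lemma dvd_pow_sub_pow_step {ϖ : B} {Q : ℕ} (hQ : ϖ ∣ (Q : B)) {k : ℕ} {x y : B}
    (h : ϖ ^ (k + 1) ∣ x - y) : ϖ ^ (k + 2) ∣ x ^ Q - y ^ Q := by
  have h1 : ϖ ∣ x - y := (dvd_pow_self ϖ (Nat.succ_ne_zero k)).trans h
  rw [← (Commute.all x y).mul_geom_sum₂, pow_succ ϖ (k + 1)]
  refine mul_dvd_mul h ?_
  rw [← Ideal.Quotient.eq_zero_iff_dvd] at h1 hQ ⊢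
  have e : Ideal.Quotient.mk (Ideal.span {ϖ}) x = Ideal.Quotient.mk _ y := by
    simpa [sub_eq_zero] using h1
  simp only [map_sum, map_mul, map_pow, e]
  rw [geom_sum₂_self, ← map_natCast (Ideal.Quotient.mk (Ideal.span {ϖ})), hQ, zero_mul]

lemma dvd_pow_sub_pow {ϖ : B} {Q : ℕ} (hQ : ϖ ∣ (Q : B)) {x y : B}
    (h : ϖ ∣ x - y) (s : ℕ) : ϖ ^ (s + 1) ∣ x ^ Q ^ s - y ^ Q ^ s := by
  induction s with
  | zero => simpa using h
  | succ s ih =>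
    rw [pow_succ Q, pow_mul, pow_mul]
    exact dvd_pow_sub_pow_step hQ ih

lemma ghost_congr {ϖ : B} {Q : ℕ} (hQ : ϖ ∣ (Q : B)) {b c : ℕ → B}
    (h : ∀ i, ϖ ∣ b i - c i) (n : ℕ) : ϖ ^ (n + 1) ∣ ghost ϖ Q n b - ghost ϖ Q n c := by
  unfold ghost
  rw [← Finset.sum_sub_distrib]
  refine Finset.dvd_sum fun i hi ↦ ?_
  have hi' : i ≤ n := Nat.lt_succ_iff.1 (Finset.mem_range.1 hi)
  rw [← mul_sub, show n + 1 = i + ((n - i) + 1) by omega, pow_add]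
  exact mul_dvd_mul_left _ (dvd_pow_sub_pow hQ (h i) _)

/-- The recursive solution of `ghost ϖ Q n b = a n`, when it exists. -/
def solve (ϖ : B) (Q : ℕ) (a : ℕ → B) : ℕ → B
  | n =>
    open Classical in
    if h : ∃ x, a n = ∑ i : Fin n, ϖ ^ i.1 * (solve ϖ Q a i.1) ^ Q ^ (n - i.1) + ϖ ^ n * x
    then h.choose else 0
  termination_by n => n
  decreasing_by exact i.2

lemma ghost_solve {ϖ : B} {Q : ℕ} {a : ℕ → B} {n : ℕ}
    (h : ∃ x, a n = ∑ i ∈ Finset.range n, ϖ ^ i * (solve ϖ Q a i) ^ Q ^ (n - i) + ϖ ^ n * x) :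
    ghost ϖ Q n (solve ϖ Q a) = a n := by
  unfold ghost
  rw [Finset.sum_range_succ]
  rw [Finset.sum_range fun i ↦ ϖ ^ i * (solve ϖ Q a i) ^ Q ^ (n - i)] at h ⊢
  conv_lhs => enter [2, 2]; rw [solve]
  rw [dif_pos h]
  have := h.choose_spec
  simpa using this.symm

/-- Dwork's integrality lemma. -/
lemma ghost_solve_of_dvd {ϖ : B} {Q : ℕ} (hQ : ϖ ∣ (Q : B)) (σ : B →+* B) (hσ : σ ϖ = ϖ)
    (hσQ : ∀ b, ϖ ∣ σ b - b ^ Q) {a : ℕ → B} (ha : ∀ n, ϖ ^ (n + 1) ∣ σ (a n) - a (n + 1))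
    (n : ℕ) : ghost ϖ Q n (solve ϖ Q a) = a n := by
  induction n with
  | zero => exact ghost_solve ⟨a 0, by simp⟩
  | succ n ih =>
    apply ghost_solve
    have h1 : ϖ ^ (n + 1) ∣ a (n + 1) - ghost ϖ Q n (fun i ↦ solve ϖ Q a i ^ Q) := by
      have h2 := ghost_congr hQ (fun i ↦ hσQ (solve ϖ Q a i)) n
      have h3 := map_ghost σ ϖ Q n (solve ϖ Q a)
      rw [hσ, ih] at h3
      rw [← h3] at h2
      have := dvd_sub h2 (ha n)
      simpa using this
    obtain ⟨x, hx⟩ := h1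
    refine ⟨x, ?_⟩
    have h4 := ghost_succ ϖ Q n (solve ϖ Q a)
    unfold ghost at h4 hx
    rw [Finset.sum_range_succ] at h4
    simp only [tsub_self, pow_zero, pow_one, add_left_inj] at h4
    rw [h4, ← hx]
    ring

lemma ghost_injective {ϖ : B} (hϖ : IsLeftRegular ϖ) (Q : ℕ) {b c : ℕ → B}
    (h : ∀ n, ghost ϖ Q n b = ghost ϖ Q n c) : b = c := by
  funext n
  induction n using Nat.strong_induction_on with
  | _ n ih =>
    have h1 := h n
    unfold ghost at h1
    rw [Finset.sum_range_succ, Finset.sum_range_succ,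
      Finset.sum_congr rfl fun i hi ↦ by rw [ih i (Finset.mem_range.1 hi)]] at h1
    simpa using (hϖ.pow n) (by simpa using h1)

end Ghost

/-! ### Discrete valuation rings with finite residue field -/

section DVR

variable {O : Type u} [CommRing O] [IsDomain O] [IsDiscreteValuationRing O] {π : O}

variable (O) in
/-- The cardinality of the residue field. -/
abbrev resCard : ℕ := Nat.card (IsLocalRing.ResidueField O)

lemma dvd_iff_residue (hπ : Irreducible π) (a : O) : π ∣ a ↔ IsLocalRing.residue O a = 0 := by
  rw [IsLocalRing.residue_eq_zero_iff, hπ.maximalIdeal_eq, Ideal.mem_span_singleton]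

variable [Finite (IsLocalRing.ResidueField O)]

lemma dvd_resCard (hπ : Irreducible π) : π ∣ (resCard O : O) := by
  have := Fintype.ofFinite (IsLocalRing.ResidueField O)
  rw [dvd_iff_residue hπ, map_natCast, resCard, Nat.card_eq_fintype_card, Nat.cast_card_eq_zero]

lemma dvd_pow_resCard_sub (hπ : Irreducible π) (a : O) : π ∣ a ^ resCard O - a := by
  rw [dvd_iff_residue hπ, map_sub, map_pow]
  have := Fintype.ofFinite (IsLocalRing.ResidueField O)
  rw [resCard, Nat.card_eq_fintype_card, FiniteField.pow_card, sub_self]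

lemma exists_resCard_eq (hπ : Irreducible π) :
    ∃ p h : ℕ, p.Prime ∧ resCard O = p ^ h ∧ π ∣ (p : O) := by
  have := Fintype.ofFinite (IsLocalRing.ResidueField O)
  obtain ⟨p, hp⟩ := CharP.exists (IsLocalRing.ResidueField O)
  obtain ⟨n, h1, h2⟩ := FiniteField.card (IsLocalRing.ResidueField O) p
  refine ⟨p, n, h1, by rw [resCard, Nat.card_eq_fintype_card, h2], ?_⟩
  rw [dvd_iff_residue hπ, map_natCast, CharP.cast_eq_zero]

open MvPolynomial in
lemma dvd_expand_sub_pow (hπ : Irreducible π) {ι : Type*} (f : MvPolynomial ι O) :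
    (C π : MvPolynomial ι O) ∣ expand (resCard O) f - f ^ resCard O := by
  obtain ⟨p, h, hp, hq, hpp⟩ := exists_resCard_eq hπ
  have hp' : (C π : MvPolynomial ι O) ∣ (p : MvPolynomial ι O) := by
    rw [← map_natCast (C : O →+* MvPolynomial ι O)]
    exact map_dvd _ hpp
  induction f using MvPolynomial.induction_on with
  | C a =>
    rw [expand_C, ← map_pow, ← map_sub, ← dvd_neg, ← map_neg, neg_sub]
    exact map_dvd _ (dvd_pow_resCard_sub hπ a)
  | add f g hf hg =>
    obtain ⟨r, hr⟩ := exists_add_pow_prime_pow_eq hp f g h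
    rw [← hq] at hr
    rw [hr, map_add]
    have := dvd_sub (dvd_add hf hg) (hp'.mul_right (f * g * r))
    convert this using 1
    ring
  | mul_X f i hf =>
    rw [map_mul, expand_X, mul_pow, ← sub_mul]
    exact hf.mul_right _

open MvPolynomial in
/-- The integrality lemma in polynomial rings over `O`. -/
lemma ghost_solve_mvPolynomial (hπ : Irreducible π) {ι : Type*} {a : ℕ → MvPolynomial ι O}
    (ha : ∀ n, (C π : MvPolynomial ι O) ^ (n + 1) ∣ expand (resCard O) (a n) - a (n + 1)) (n : ℕ) :
    ghost (C π) (resCard O) n (solve (C π) (resCard O) a) = a n := by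
  have h1 : (C π : MvPolynomial ι O) ∣ (resCard O : MvPolynomial ι O) := by
    rw [← map_natCast (C : O →+* MvPolynomial ι O)]
    exact map_dvd _ (dvd_resCard hπ)
  exact ghost_solve_of_dvd h1 (expand (resCard O) : MvPolynomial ι O →ₐ[O] MvPolynomial ι O)
    (by simp) (fun b ↦ dvd_expand_sub_pow hπ b) ha n

end DVR

end RamifiedWitt

namespace RamifiedWitt

open MvPolynomial

variable {O : Type u} [CommRing O] [IsDomain O] [IsDiscreteValuationRing O] {π : O}

/-! ### Ramified Witt vectors -/

/-- Ramified Witt vectors over `O` with respect to the uniformizer `π` (and the cardinality of the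
residue field of `O`), with coefficients in `B`. -/
def WittVec (_hπ : Irreducible π) (B : Type v) : Type v := ℕ → B

variable (π) in
/-- The addition polynomials: the `n`-th Witt polynomial of `addPoly π` is the sum of the `n`-th
Witt polynomials of the two sets of variables. -/
def addPoly : ℕ → MvPolynomial (ℕ ⊕ ℕ) O :=
  solve (C π) (resCard O) fun n ↦
    ghost (C π) (resCard O) n (fun i ↦ X (Sum.inl i)) +
      ghost (C π) (resCard O) n (fun i ↦ X (Sum.inr i))

variable (π) in
/-- The multiplication polynomials. -/
def mulPoly : ℕ → MvPolynomial (ℕ ⊕ ℕ) O :=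
  solve (C π) (resCard O) fun n ↦
    ghost (C π) (resCard O) n (fun i ↦ X (Sum.inl i)) *
      ghost (C π) (resCard O) n (fun i ↦ X (Sum.inr i))

variable (π) in
/-- The negation polynomials. -/
def negPoly : ℕ → MvPolynomial ℕ O :=
  solve (C π) (resCard O) fun n ↦ - ghost (C π) (resCard O) n X

namespace WittVec

variable {hπ : Irreducible π} {B : Type*} [CommRing B] [Algebra O B]

instance : Zero (WittVec hπ B) := ⟨fun _ ↦ 0⟩

instance : One (WittVec hπ B) := ⟨fun n ↦ if n = 0 then 1 else 0⟩

instance : Add (WittVec hπ B) := ⟨fun a b n ↦ aeval (Sum.elim a b) (addPoly π n)⟩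

instance : Mul (WittVec hπ B) := ⟨fun a b n ↦ aeval (Sum.elim a b) (mulPoly π n)⟩

instance : Neg (WittVec hπ B) := ⟨fun a n ↦ aeval a (negPoly π n)⟩

/-- The ghost components. -/
def gh (n : ℕ) (a : WittVec hπ B) : B := ghost (algebraMap O B π) (resCard O) n a

/-- Functoriality in the ring of coefficients. -/
def mapFun {B' : Type*} (f : B → B') (a : WittVec hπ B) : WittVec hπ B' := fun n ↦ f (a n)

section map

variable {B' : Type*} [CommRing B'] [Algebra O B'] (f : B →ₐ[O] B')

lemma mapFun_add (a b : WittVec hπ B) : mapFun f (a + b) = mapFun f a + mapFun f b := by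
  funext n
  change f (aeval (Sum.elim a b) (addPoly π n)) =
    aeval (Sum.elim (mapFun f a) (mapFun f b)) (addPoly π n)
  rw [← AlgHom.comp_apply, comp_aeval]
  congr 2
  funext i
  cases i <;> rfl

lemma mapFun_mul (a b : WittVec hπ B) : mapFun f (a * b) = mapFun f a * mapFun f b := by
  funext n
  change f (aeval (Sum.elim a b) (mulPoly π n)) =
    aeval (Sum.elim (mapFun f a) (mapFun f b)) (mulPoly π n)
  rw [← AlgHom.comp_apply, comp_aeval]
  congr 2
  funext i
  cases i <;> rfl

lemma mapFun_neg (a : WittVec hπ B) : mapFun f (-a) = -mapFun f a := by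
  funext n
  exact AlgHom.congr_fun (comp_aeval (fun i ↦ a i) f) (negPoly π n)

lemma mapFun_zero : mapFun f (0 : WittVec hπ B) = 0 := by
  funext n
  exact map_zero f

lemma mapFun_one : mapFun f (1 : WittVec hπ B) = 1 := by
  funext n
  change f (if n = 0 then 1 else 0) = if n = 0 then 1 else 0
  split_ifs
  exacts [map_one f, map_zero f]

end map

lemma resCard_ne_zero [Finite (IsLocalRing.ResidueField O)] : resCard O ≠ 0 := Nat.card_pos.ne'

section ghost

variable [Finite (IsLocalRing.ResidueField O)]

lemma dvd_expand_ghost {ι : Type*} (j : ℕ → ι) (n : ℕ) :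
    (C π : MvPolynomial ι O) ^ (n + 1) ∣
      expand (resCard O) (ghost (C π) (resCard O) n (fun i ↦ X (j i))) -
      ghost (C π) (resCard O) (n + 1) (fun i ↦ X (j i)) := by
  have h := map_ghost (expand (resCard O) : MvPolynomial ι O →ₐ[O] MvPolynomial ι O).toRingHom
    (C π) (resCard O) n (fun i ↦ X (j i))
  simp only [AlgHom.toRingHom_eq_coe, RingHom.coe_coe, expand_C, expand_X] at h
  rw [h, ghost_succ, sub_add_cancel_left, dvd_neg]
  exact dvd_mul_right _ _

lemma ghost_addPoly (hπ : Irreducible π) (n : ℕ) : ghost (C π) (resCard O) n (addPoly π) =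
    ghost (C π) (resCard O) n (fun i ↦ X (Sum.inl i)) +
      ghost (C π) (resCard O) n (fun i ↦ X (Sum.inr i)) := by
  refine ghost_solve_mvPolynomial hπ (fun n ↦ ?_) n
  rw [map_add, add_sub_add_comm]
  exact dvd_add (dvd_expand_ghost _ n) (dvd_expand_ghost _ n)

lemma ghost_mulPoly (hπ : Irreducible π) (n : ℕ) : ghost (C π) (resCard O) n (mulPoly π) =
    ghost (C π) (resCard O) n (fun i ↦ X (Sum.inl i)) *
      ghost (C π) (resCard O) n (fun i ↦ X (Sum.inr i)) := by
  refine ghost_solve_mvPolynomial hπ (fun n ↦ ?_) n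
  rw [map_mul]
  exact dvd_mul_sub_mul (dvd_expand_ghost _ n) (dvd_expand_ghost _ n)

lemma ghost_negPoly (hπ : Irreducible π) (n : ℕ) : ghost (C π) (resCard O) n (negPoly π) =
    - ghost (C π) (resCard O) n X := by
  refine ghost_solve_mvPolynomial hπ (fun n ↦ ?_) n
  rw [map_neg, neg_sub_neg, ← dvd_neg, neg_sub]
  exact dvd_expand_ghost _ n

lemma aeval_ghost {ι : Type*} (v : ι → B) (n : ℕ) (b : ℕ → MvPolynomial ι O) :
    aeval v (ghost (C π) (resCard O) n b) =
      ghost (algebraMap O B π) (resCard O) n (fun i ↦ aeval v (b i)) := by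
  have := map_ghost (aeval v : MvPolynomial ι O →ₐ[O] B).toRingHom (C π) (resCard O) n b
  simpa using this

lemma gh_add (n : ℕ) (a b : WittVec hπ B) : gh n (a + b) = gh n a + gh n b := by
  have h := congrArg (aeval (Sum.elim (fun i ↦ a i) (fun i ↦ b i))) (ghost_addPoly hπ n)
  rw [map_add, aeval_ghost, aeval_ghost, aeval_ghost] at h
  simp only [aeval_X, Sum.elim_inl, Sum.elim_inr] at h
  exact h

lemma gh_mul (n : ℕ) (a b : WittVec hπ B) : gh n (a * b) = gh n a * gh n b := by
  have h := congrArg (aeval (Sum.elim (fun i ↦ a i) (fun i ↦ b i))) (ghost_mulPoly hπ n)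
  rw [map_mul, aeval_ghost, aeval_ghost, aeval_ghost] at h
  simp only [aeval_X, Sum.elim_inl, Sum.elim_inr] at h
  exact h

lemma gh_neg (n : ℕ) (a : WittVec hπ B) : gh n (-a) = - gh n a := by
  have h := congrArg (aeval (fun i ↦ a i)) (ghost_negPoly hπ n)
  rw [map_neg, aeval_ghost, aeval_ghost] at h
  simp only [aeval_X] at h
  exact h

lemma gh_zero (n : ℕ) : gh n (0 : WittVec hπ B) = 0 := by
  unfold gh ghost
  refine Finset.sum_eq_zero fun i _ ↦ ?_
  change (algebraMap O B π) ^ i * (0 : B) ^ (resCard O ^ (n - i)) = 0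
  rw [zero_pow (pow_ne_zero _ resCard_ne_zero), mul_zero]

lemma gh_one (n : ℕ) : gh n (1 : WittVec hπ B) = 1 := by
  change ∑ i ∈ Finset.range (n + 1), _ ^ i * (if i = 0 then (1 : B) else 0) ^ _ = 1
  rw [Finset.sum_eq_single 0]
  · simp
  · intro i _ hi
    rw [if_neg hi, zero_pow (pow_ne_zero _ resCard_ne_zero), mul_zero]
  · simp

variable (hπ) in
lemma gh_ext {ι : Type*} {a b : WittVec hπ (MvPolynomial ι O)} (h : ∀ n, gh n a = gh n b) :
    a = b :=
  ghost_injective (IsLeftCancelMulZero.mul_left_cancel_of_ne_zero (by simpa using hπ.ne_zero))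
    (resCard O) h

end ghost

lemma exists_mapFun_eq (a : WittVec hπ B) :
    ∃ a' : WittVec hπ (MvPolynomial B O), mapFun (aeval (R := O) (id : B → B)) a' = a :=
  ⟨fun n ↦ X (a n), funext fun n ↦ by simp [mapFun]⟩

instance [Finite (IsLocalRing.ResidueField O)] : CommRing (WittVec hπ B) :=
  CommRing.ofMinimalAxioms
    (fun a b c ↦ by
      obtain ⟨a, rfl⟩ := exists_mapFun_eq a
      obtain ⟨b, rfl⟩ := exists_mapFun_eq b
      obtain ⟨c, rfl⟩ := exists_mapFun_eq c
      simp only [← mapFun_add]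
      exact congrArg _ (gh_ext hπ fun n ↦ by simp only [gh_add]; ring))
    (fun a ↦ by
      obtain ⟨a, rfl⟩ := exists_mapFun_eq a
      rw [← mapFun_zero (aeval (R := O) (id : B → B)), ← mapFun_add]
      exact congrArg _ (gh_ext hπ fun n ↦ by simp only [gh_add, gh_zero]; ring))
    (fun a ↦ by
      obtain ⟨a, rfl⟩ := exists_mapFun_eq a
      rw [← mapFun_zero (aeval (R := O) (id : B → B)), ← mapFun_neg, ← mapFun_add]
      exact congrArg _ (gh_ext hπ fun n ↦ by simp only [gh_add, gh_neg, gh_zero]; ring))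
    (fun a b c ↦ by
      obtain ⟨a, rfl⟩ := exists_mapFun_eq a
      obtain ⟨b, rfl⟩ := exists_mapFun_eq b
      obtain ⟨c, rfl⟩ := exists_mapFun_eq c
      simp only [← mapFun_mul]
      exact congrArg _ (gh_ext hπ fun n ↦ by simp only [gh_mul]; ring))
    (fun a b ↦ by
      obtain ⟨a, rfl⟩ := exists_mapFun_eq a
      obtain ⟨b, rfl⟩ := exists_mapFun_eq b
      simp only [← mapFun_mul]
      exact congrArg _ (gh_ext hπ fun n ↦ by simp only [gh_mul]; ring))
    (fun a ↦ by
      obtain ⟨a, rfl⟩ := exists_mapFun_eq a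
      rw [← mapFun_one (aeval (R := O) (id : B → B)), ← mapFun_mul]
      exact congrArg _ (gh_ext hπ fun n ↦ by simp only [gh_mul, gh_one]; ring))
    (fun a b c ↦ by
      obtain ⟨a, rfl⟩ := exists_mapFun_eq a
      obtain ⟨b, rfl⟩ := exists_mapFun_eq b
      obtain ⟨c, rfl⟩ := exists_mapFun_eq c
      simp only [← mapFun_mul, ← mapFun_add]
      exact congrArg _ (gh_ext hπ fun n ↦ by simp only [gh_mul, gh_add]; ring))

variable [Finite (IsLocalRing.ResidueField O)]

/-- Functoriality in the ring of coefficients. -/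
def map {B' : Type*} [CommRing B'] [Algebra O B'] (f : B →ₐ[O] B') :
    WittVec hπ B →+* WittVec hπ B' where
  toFun := mapFun f
  map_zero' := mapFun_zero f
  map_one' := mapFun_one f
  map_add' := mapFun_add f
  map_mul' := mapFun_mul f

end WittVec

/-! ### Drinfeld's map -/

section Drinfeld

variable {O' : Type u} [CommRing O'] [IsDomain O'] [IsDiscreteValuationRing O'] [Algebra O O']
  {ϖ : O'}

variable (π ϖ) in
/-- The components of Drinfeld's morphism: polynomials over `O'` whose `n`-th Witt polynomial with
respect to `O'` is the `r n`-th Witt polynomial of the variables with respect to `O`. -/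
def drinfeldPoly (r : ℕ) : ℕ → MvPolynomial ℕ O' :=
  solve (C ϖ) (resCard O') fun n ↦ ghost (C (algebraMap O O' π)) (resCard O) (r * n) X

lemma dvd_ghost_sub {B : Type*} [CommRing B] (π : B) (Q n s : ℕ) (b : ℕ → B) :
    π ^ (n + 1) ∣ ghost π Q n (fun i ↦ b i ^ Q ^ s) - ghost π Q (n + s) b := by
  induction s generalizing b with
  | zero => simp
  | succ s ih =>
    have h := ih (fun i ↦ b i ^ Q)
    simp only [← pow_mul, ← pow_succ'] at h
    rw [← add_assoc, ghost_succ, ← sub_sub]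
    exact dvd_sub h ((pow_dvd_pow _ (by omega)).mul_right _)

variable [Finite (IsLocalRing.ResidueField O)] [Finite (IsLocalRing.ResidueField O')]

lemma ne_zero_of_resCard_eq {r : ℕ} (hr : resCard O' = resCard O ^ r) : r ≠ 0 := by
  rintro rfl
  have : 1 < resCard O' := Finite.one_lt_card
  rw [hr, pow_zero] at this
  exact lt_irrefl _ this

lemma ghost_drinfeldPoly [Module.Finite O O'] [FaithfulSMul O O']
    (hπ : Irreducible π) (hϖ : Irreducible ϖ) {r : ℕ} (hr : resCard O' = resCard O ^ r) (n : ℕ) :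
    ghost (C ϖ) (resCard O') n (drinfeldPoly π ϖ r) =
      ghost (C (algebraMap O O' π)) (resCard O) (r * n) X := by
  refine ghost_solve_mvPolynomial hϖ (fun n ↦ ?_) n
  have h := map_ghost
    (expand (resCard O') : MvPolynomial ℕ O' →ₐ[O'] MvPolynomial ℕ O').toRingHom
    (C (algebraMap O O' π)) (resCard O) (r * n) X
  simp only [AlgHom.toRingHom_eq_coe, RingHom.coe_coe, expand_C, expand_X] at h
  rw [h, hr, mul_add, mul_one]
  refine dvd_trans ?_ (dvd_ghost_sub (C (algebraMap O O' π)) (resCard O) (r * n) r X)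
  have h1 : ϖ ∣ algebraMap O O' π := by
    rw [← Ideal.mem_span_singleton, ← hϖ.maximalIdeal_eq, IsLocalRing.mem_maximalIdeal]
    exact fun h ↦ hπ.not_isUnit (isUnit_of_map_unit (algebraMap O O') π h)
  refine (pow_dvd_pow_of_dvd (map_dvd C h1) _).trans (pow_dvd_pow _ ?_)
  have := Nat.le_mul_of_pos_left n (Nat.pos_of_ne_zero (ne_zero_of_resCard_eq hr))
  omega

namespace WittVec

variable [Module.Finite O O'] [FaithfulSMul O O'] {hπ : Irreducible π} {hϖ : Irreducible ϖ}
  {B : Type*} [CommRing B] [Algebra O B] [Algebra O' B]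

/-- Drinfeld's map on coefficients. -/
def drinfeldFun (hϖ : Irreducible ϖ) (r : ℕ) (a : WittVec hπ B) : WittVec hϖ B :=
  fun n ↦ aeval (fun i ↦ a i) (drinfeldPoly π ϖ r n)

lemma mapFun_drinfeldFun (r : ℕ) {B' : Type*} [CommRing B'] [Algebra O' B'] (f : B →ₐ[O'] B')
    (a : WittVec hπ B) : mapFun f (drinfeldFun hϖ r a) = drinfeldFun hϖ r (mapFun f a) := by
  funext n
  exact AlgHom.congr_fun (comp_aeval (fun i ↦ a i) f) (drinfeldPoly π ϖ r n)

lemma gh_drinfeldFun [IsScalarTower O O' B] {r : ℕ} (hr : resCard O' = resCard O ^ r) (n : ℕ)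
    (a : WittVec hπ B) : gh n (drinfeldFun hϖ r a) = gh (r * n) a := by
  have h := congrArg (aeval (fun i ↦ a i)) (ghost_drinfeldPoly hπ hϖ hr n)
  rw [aeval_ghost] at h
  have h2 := map_ghost (aeval (fun i ↦ a i) : MvPolynomial ℕ O' →ₐ[O'] B).toRingHom
    (C (algebraMap O O' π)) (resCard O) (r * n) X
  simp only [AlgHom.toRingHom_eq_coe, RingHom.coe_coe, aeval_C, aeval_X,
    ← IsScalarTower.algebraMap_apply O O' B] at h2
  exact h.trans h2

/-- Every ring of Witt vectors is a quotient of one with coefficients in a polynomial ring. -/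
lemma exists_mapFun_eq' (a : WittVec hπ B) :
    ∃ a' : WittVec hπ (MvPolynomial B O'), mapFun (aeval (R := O') (id : B → B)) a' = a :=
  ⟨fun n ↦ X (a n), funext fun n ↦ by simp [mapFun]⟩

variable [IsScalarTower O O' B]

/-- Drinfeld's map, as a homomorphism of rings. -/
def drinfeldMap (hπ : Irreducible π) (hϖ : Irreducible ϖ) {r : ℕ}
    (hr : resCard O' = resCard O ^ r) : WittVec hπ B →+* WittVec hϖ B where
  toFun := drinfeldFun hϖ r
  map_zero' := by
    rw [← mapFun_zero ((aeval (R := O') (id : B → B)).restrictScalars O),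
      ← mapFun_zero (aeval (R := O') (id : B → B))]
    refine (mapFun_drinfeldFun r (aeval (R := O') (id : B → B)) _).symm.trans ?_
    exact congrArg _ (gh_ext hϖ fun n ↦ by simp only [gh_drinfeldFun hr, gh_zero])
  map_one' := by
    rw [← mapFun_one ((aeval (R := O') (id : B → B)).restrictScalars O),
      ← mapFun_one (aeval (R := O') (id : B → B))]
    refine (mapFun_drinfeldFun r (aeval (R := O') (id : B → B)) _).symm.trans ?_
    exact congrArg _ (gh_ext hϖ fun n ↦ by simp only [gh_drinfeldFun hr, gh_one])
  map_add' a b := by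
    obtain ⟨a, rfl⟩ := exists_mapFun_eq' (O' := O') a
    obtain ⟨b, rfl⟩ := exists_mapFun_eq' (O' := O') b
    rw [← mapFun_drinfeldFun, ← mapFun_drinfeldFun, ← mapFun_add]
    refine (congrArg _ (mapFun_add ((aeval (R := O') (id : B → B)).restrictScalars O) a b).symm
      |>.trans (mapFun_drinfeldFun r (aeval (R := O') (id : B → B)) _).symm).trans ?_
    exact congrArg _ (gh_ext hϖ fun n ↦ by simp only [gh_drinfeldFun hr, gh_add])
  map_mul' a b := by
    obtain ⟨a, rfl⟩ := exists_mapFun_eq' (O' := O') a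
    obtain ⟨b, rfl⟩ := exists_mapFun_eq' (O' := O') b
    rw [← mapFun_drinfeldFun, ← mapFun_drinfeldFun, ← mapFun_mul]
    refine (congrArg _ (mapFun_mul ((aeval (R := O') (id : B → B)).restrictScalars O) a b).symm
      |>.trans (mapFun_drinfeldFun r (aeval (R := O') (id : B → B)) _).symm).trans ?_
    exact congrArg _ (gh_ext hϖ fun n ↦ by simp only [gh_drinfeldFun hr, gh_mul])

end WittVec

end Drinfeld

end RamifiedWitt

namespace RamifiedWitt

open MvPolynomial AlgebraicGeometry CategoryTheory Limits Opposite

/-! ### Ramified Witt vectors as a group scheme -/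

section Scheme

/-- The scheme `Spec R[X₀, X₁, …]` over `Spec R`. -/
abbrev affineSpace (R : Type u) [CommRing R] : Over (Spec (.of R)) :=
  Over.mk (Spec.map (CommRingCat.ofHom (C : R →+* MvPolynomial ℕ R)))

/-- The `R`-algebra of global sections of a scheme over `Spec R`. -/
abbrev sections {R : Type u} [CommRing R] (T : Over (Spec (.of R))) : CommAlgCat R :=
  ((algΓ (.of R)).obj T).unop

lemma algebraMap_sections {R : Type u} [CommRing R] (T : Over (Spec (.of R))) (x : R) :
    algebraMap R (sections T) x = T.hom.appTop ((Scheme.ΓSpecIso (.of R)).inv x) := rfl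

lemma eq_toSpecΓ_comp {X : Scheme.{u}} {A : CommRingCat.{u}} (f : X ⟶ Spec A) :
    f = X.toSpecΓ ≫ Spec.map ((Scheme.ΓSpecIso A).inv ≫ f.appTop) := by
  rw [Spec.map_comp, ← Scheme.toSpecΓ_naturality_assoc, toSpecΓ_SpecMap_ΓSpecIso_inv,
    Category.comp_id]

lemma ΓSpecIso_inv_comp_appTop {X : Scheme.{u}} {A A' : CommRingCat.{u}} (φ : A ⟶ A')
    (f : X ⟶ Spec A') (g : X ⟶ Spec A) (h : f ≫ Spec.map φ = g) :
    (Scheme.ΓSpecIso A).inv ≫ g.appTop = φ ≫ (Scheme.ΓSpecIso A').inv ≫ f.appTop := by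
  rw [Scheme.ΓSpecIso_inv_naturality_assoc, ← Scheme.Hom.comp_appTop, h]

variable {R : Type u} [CommRing R]

/-- Morphisms to `Spec R[X₀, X₁, …]` are sequences of global sections. -/
def homEquiv (T : Over (Spec (.of R))) : (T ⟶ affineSpace R) ≃ (ℕ → sections T) where
  toFun f i := f.left.appTop ((Scheme.ΓSpecIso (.of (MvPolynomial ℕ R))).inv (X i))
  invFun v := Over.homMk (T.left.toSpecΓ ≫
    Spec.map (CommRingCat.ofHom (aeval v : MvPolynomial ℕ R →ₐ[R] sections T).toRingHom)) <| by
      refine Eq.trans ?_ (eq_toSpecΓ_comp T.hom).symm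
      simp only [affineSpace, Over.mk_hom, Category.assoc, ← Spec.map_comp]
      congr 2
      ext x
      exact (aeval v : MvPolynomial ℕ R →ₐ[R] sections T).commutes x
  left_inv f := by
    ext1
    refine Eq.trans ?_ (eq_toSpecΓ_comp f.left).symm
    simp only [Over.homMk_left]
    congr 2
    refine CommRingCat.hom_ext (MvPolynomial.ringHom_ext (fun x ↦ ?_) fun i ↦ ?_)
    · refine (aeval_C (S₁ := sections T) _ x).trans ?_
      exact ConcreteCategory.congr_hom (ΓSpecIso_inv_comp_appTop (CommRingCat.ofHom C) f.left T.hom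
        (Over.w f)) x
    · exact aeval_X (S₁ := sections T) _ i
  right_inv v := by
    funext i
    have h : (Scheme.ΓSpecIso (.of (MvPolynomial ℕ R))).inv ≫ (T.left.toSpecΓ ≫
        Spec.map (CommRingCat.ofHom
          (aeval v : MvPolynomial ℕ R →ₐ[R] sections T).toRingHom)).appTop =
        CommRingCat.ofHom (aeval v : MvPolynomial ℕ R →ₐ[R] sections T).toRingHom := by
      simp
      rfl
    exact (ConcreteCategory.congr_hom h (X i)).trans (aeval_X (S₁ := sections T) _ i)

lemma homEquiv_comp {S T : Over (Spec (.of R))} (g : S ⟶ T) (f : T ⟶ affineSpace R) (i : ℕ) :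
    homEquiv S (g ≫ f) i = ((algΓ (.of R)).map g).unop.hom (homEquiv T f i) := by
  simp [homEquiv]
  rfl

variable {O : Type u} [CommRing O] [IsDomain O] [IsDiscreteValuationRing O]
  [Finite (IsLocalRing.ResidueField O)] {π : O}

/-- The ring of ramified Witt vectors as a functor on `O`-algebras. -/
def wittFunctor (hπ : Irreducible π) : CommAlgCat.{u} O ⥤ CommRingCat.{u} where
  obj B := .of (WittVec hπ B)
  map f := CommRingCat.ofHom (WittVec.map f.hom)

/-- The ring of ramified Witt vectors of the global sections, as a presheaf of rings on schemes
over `Spec O`. -/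
def wittPresheaf (hπ : Irreducible π) : (Over (Spec (.of O)))ᵒᵖ ⥤ CommRingCat.{u} :=
  (algΓ (.of O)).leftOp ⋙ wittFunctor hπ

/-- `Spec O[X₀, X₁, …]` represents the presheaf of rings `wittPresheaf`. -/
def wittRepresentableBy (hπ : Irreducible π) :
    (wittPresheaf hπ ⋙ forget CommRingCat).RepresentableBy (affineSpace O) where
  homEquiv {T} := homEquiv T
  homEquiv_comp g f := funext fun i ↦ homEquiv_comp g f i

/-- The additive groups underlying `wittPresheaf`, written multiplicatively. -/
def wittGrpPresheaf (hπ : Irreducible π) : (Over (Spec (.of O)))ᵒᵖ ⥤ GrpCat.{u} :=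
  wittPresheaf hπ ⋙ forget₂ CommRingCat RingCat ⋙ forget₂ RingCat AddCommGrpCat ⋙
    forget₂ AddCommGrpCat AddGrpCat ⋙ AddGrpCat.toGrp

/-- `Spec O[X₀, X₁, …]` represents the presheaf of groups `wittGrpPresheaf`. -/
def wittGrpRepresentableBy (hπ : Irreducible π) :
    (wittGrpPresheaf hπ ⋙ forget GrpCat).RepresentableBy (affineSpace O) where
  homEquiv {T} := homEquiv T
  homEquiv_comp g f := funext fun i ↦ homEquiv_comp g f i

/-- The scheme of ramified Witt vectors over `Spec O`, as a (commutative) group scheme. -/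
def wittScheme (hπ : Irreducible π) : Grp (Over (Spec (.of O))) where
  X := affineSpace O
  grp := GrpObj.ofRepresentableBy _ _ (wittGrpRepresentableBy hπ)

end Scheme

end RamifiedWitt

namespace RamifiedWitt

open MvPolynomial AlgebraicGeometry CategoryTheory Limits Opposite MonoidalCategory
  CartesianMonoidalCategory MonObj

section BaseChange

open scoped Obj

variable {S S' : Scheme.{u}} {b : S' ⟶ S}

/-- Morphisms of `S'`-schemes to a base change are morphisms of `S`-schemes. -/
def toBase {Y : Over S} {T : Over S'} (f : T ⟶ (Over.pullback b).obj Y) : (Over.map b).obj T ⟶ Y :=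
  Over.homMk (f.left ≫ pullback.fst Y.hom b) <| by
    have := Over.w f
    simp only [Over.pullback_obj_hom] at this
    simp [pullback.condition, reassoc_of% this]

lemma toBase_mul {Y : Over S} [GrpObj Y] {T : Over S'} (f g : T ⟶ (Over.pullback b).obj Y) :
    toBase (f * g) = toBase f * toBase g := by
  ext1
  have lift_left_fst {Z : Scheme.{u}} {A B X : Over Z} (f : A ⟶ B) (g : A ⟶ X) :
      (lift f g).left ≫ pullback.fst B.hom X.hom = f.left := congrArg (·.left) (lift_fst f g)
  have lift_left_snd {Z : Scheme.{u}} {A B X : Over Z} (f : A ⟶ B) (g : A ⟶ X) :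
      (lift f g).left ≫ pullback.snd B.hom X.hom = g.left := congrArg (·.left) (lift_snd f g)
  have h : (lift f g).left ≫ (Functor.LaxMonoidal.μ (Over.pullback b) Y Y).left ≫
      pullback.fst _ _ = (lift (toBase f) (toBase g)).left := by
    refine pullback.hom_ext ?_ ?_
    · simp only [Category.assoc, Over.μ_pullback_left_fst_fst]
      rw [← Category.assoc, lift_left_fst, lift_left_fst]
      rfl
    · simp only [Category.assoc, Over.μ_pullback_left_fst_snd]
      rw [← Category.assoc, lift_left_snd, lift_left_snd]
      rfl
  have h2 : ((Over.pullback b).map μ[Y]).left ≫ pullback.fst Y.hom b =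
      pullback.fst _ _ ≫ μ[Y].left := pullback.lift_fst _ _ _
  rw [Hom.mul_def (toBase f), Over.comp_left, ← h]
  simp only [Hom.mul_def, Over.comp_left, toBase, Over.homMk_left, Functor.obj.μ_def,
    Category.assoc, h2]

lemma isMonHom_of_map_mul {C : Type*} [Category C] [CartesianMonoidalCategory C] {G H : C}
    [GrpObj G] [GrpObj H] (u : G ⟶ H)
    (hu : ∀ (T : C) (f g : T ⟶ G), (f * g) ≫ u = (f ≫ u) * (g ≫ u)) : IsMonHom u where
  one_hom := by
    have h := hu _ (η[G]) (η[G])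
    rw [one_eq_one, _root_.one_mul] at h
    rw [one_eq_one, one_eq_one]
    exact left_eq_mul.mp h
  mul_hom := by
    have h := hu _ (fst G G) (snd G G)
    simp only [Hom.mul_def, lift_fst_snd, Category.id_comp] at h
    rw [h]
    congr 1
    ext <;> simp

end BaseChange

end RamifiedWitt

namespace RamifiedWitt

open MvPolynomial AlgebraicGeometry CategoryTheory Limits Opposite MonoidalCategory
  CartesianMonoidalCategory MonObj

section DrinfeldMorphism

variable (O : Type u) [CommRing O] (O' : Type u) [CommRing O'] [Algebra O O']

/-- The structure morphism `Spec O' ⟶ Spec O`. -/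
abbrev baseMap : Spec (.of O') ⟶ Spec (.of O) := Spec.map (CommRingCat.ofHom (algebraMap O O'))

variable {O O'}

/-- A morphism of `Spec O'`-schemes to the base change of `Spec O[X₀, X₁, …]`, as a sequence of
global sections. -/
def coords {T : Over (Spec (.of O'))} (f : T ⟶ (Over.pullback (baseMap O O')).obj (affineSpace O)) :
    ℕ → sections T :=
  homEquiv ((Over.map (baseMap O O')).obj T) (toBase f)

lemma coords_comp {S T : Over (Spec (.of O'))} (g : S ⟶ T)
    (f : T ⟶ (Over.pullback (baseMap O O')).obj (affineSpace O)) (i : ℕ) :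
    coords (g ≫ f) i = ((algΓ (.of O')).map g).unop.hom (coords f i) := by
  refine Eq.trans ?_ (homEquiv_comp ((Over.map (baseMap O O')).map g) (toBase f) i)
  have : toBase (g ≫ f) = (Over.map (baseMap O O')).map g ≫ toBase f := by
    ext1
    simp [toBase]
  rw [coords, this]

variable [IsDomain O] [IsDiscreteValuationRing O] [IsDomain O'] [IsDiscreteValuationRing O']

variable (O O') in
/-- Drinfeld's morphism, as a morphism of schemes over `Spec O'`: in coordinates it is given by the
polynomials `drinfeldPoly`. -/
def drinfeldHom (π : O) (ϖ : O') (r : ℕ) :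
    (Over.pullback (baseMap O O')).obj (affineSpace O) ⟶ affineSpace O' :=
  (homEquiv _).symm fun n ↦ aeval (coords (𝟙 _)) (drinfeldPoly π ϖ r n)

variable {π : O} {ϖ : O'}

lemma homEquiv_comp_drinfeldHom (r : ℕ) {T : Over (Spec (.of O'))}
    (f : T ⟶ (Over.pullback (baseMap O O')).obj (affineSpace O)) :
    homEquiv T (f ≫ drinfeldHom O O' π ϖ r) = fun n ↦ aeval (coords f) (drinfeldPoly π ϖ r n) := by
  funext n
  rw [homEquiv_comp, drinfeldHom, Equiv.apply_symm_apply, ← AlgHom.comp_apply, comp_aeval]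
  have h : (fun i ↦ ((algΓ (.of O')).map f).unop.hom (coords (𝟙 _) i)) = coords f :=
    funext fun i ↦ (coords_comp f (𝟙 _) i).symm.trans (by rw [Category.comp_id])
  rw [← h]

variable [Finite (IsLocalRing.ResidueField O)] [Finite (IsLocalRing.ResidueField O')]

/-- Sections of the scheme of ramified Witt vectors are ramified Witt vectors. -/
def wittEquiv (hπ : Irreducible π) (T : Over (Spec (.of O))) :
    (T ⟶ (wittScheme hπ).X) ≃ WittVec hπ (sections T) := homEquiv T

lemma wittEquiv_mul (hπ : Irreducible π) {T : Over (Spec (.of O))} (f g : T ⟶ (wittScheme hπ).X) :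
    wittEquiv hπ T (f * g) = wittEquiv hπ T f + wittEquiv hπ T g :=
  ((yonedaGrpObjIsoOfRepresentableBy _ _ (wittGrpRepresentableBy hπ)).hom.app (op T)).hom.map_mul
    f g

variable [Module.Finite O O'] [FaithfulSMul O O']

lemma drinfeldHom_mul (hπ : Irreducible π) (hϖ : Irreducible ϖ) {r : ℕ}
    (hr : resCard O' = resCard O ^ r) {T : Over (Spec (.of O'))}
    (f g : T ⟶ ((Over.pullback (baseMap O O')).mapGrp.obj (wittScheme hπ)).X)
    (u : ((Over.pullback (baseMap O O')).mapGrp.obj (wittScheme hπ)).X ⟶ (wittScheme hϖ).X)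
    (hu : u = drinfeldHom O O' π ϖ r) :
    (f * g) ≫ u = (f ≫ u) * (g ≫ u) := by
  let : Algebra O (sections T) :=
    inferInstanceAs (Algebra O (sections ((Over.map (baseMap O O')).obj T)))
  have : IsScalarTower O O' (sections T) := IsScalarTower.of_algebraMap_eq fun x ↦
    ConcreteCategory.congr_hom (ΓSpecIso_inv_comp_appTop (CommRingCat.ofHom (algebraMap O O'))
      T.hom ((Over.map (baseMap O O')).obj T).hom rfl) x
  let c (f : T ⟶ ((Over.pullback (baseMap O O')).mapGrp.obj (wittScheme hπ)).X) :
    WittVec hπ (sections T) := coords f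
  have hc : c (f * g) = c f + c g :=
    (congrArg (wittEquiv hπ ((Over.map (baseMap O O')).obj T)) (toBase_mul f g)).trans
      (wittEquiv_mul hπ _ _)
  have key (f) : wittEquiv hϖ T (f ≫ u) = WittVec.drinfeldMap hπ hϖ hr (c f) := by
    rw [hu]
    exact homEquiv_comp_drinfeldHom r f
  apply (wittEquiv hϖ T).injective
  rw [wittEquiv_mul, key, key, key, hc, map_add]

/-- Drinfeld's morphism, as a morphism of group schemes over `Spec O'` from the base change of the
scheme of ramified Witt vectors over `O` to the scheme of ramified Witt vectors over `O'`. -/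
def drinfeld (hπ : Irreducible π) (hϖ : Irreducible ϖ) {r : ℕ}
    (hr : resCard O' = resCard O ^ r) :
    (Over.pullback (baseMap O O')).mapGrp.obj (wittScheme hπ) ⟶ wittScheme hϖ :=
  let u : ((Over.pullback (baseMap O O')).mapGrp.obj (wittScheme hπ)).X ⟶ (wittScheme hϖ).X :=
    drinfeldHom O O' π ϖ r
  have : IsMonHom u := isMonHom_of_map_mul u fun _ f g ↦ drinfeldHom_mul hπ hϖ hr f g u rfl
  Grp.homMk u

/-- The restriction of Drinfeld's morphism to the special fibers: its base change to the residue
field of `O'`. -/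
def drinfeldSpecialFiber (hπ : Irreducible π) (hϖ : Irreducible ϖ) {r : ℕ}
    (hr : resCard O' = resCard O ^ r) :
    (Over.pullback (baseMap O' (IsLocalRing.ResidueField O'))).mapGrp.obj
        ((Over.pullback (baseMap O O')).mapGrp.obj (wittScheme hπ)) ⟶
      (Over.pullback (baseMap O' (IsLocalRing.ResidueField O'))).mapGrp.obj (wittScheme hϖ) :=
  (Over.pullback (baseMap O' (IsLocalRing.ResidueField O'))).mapGrp.map (drinfeld hπ hϖ hr)

end DrinfeldMorphism

/-! ### Universal homeomorphisms and pro-infinitesimal group schemes -/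

/-- A morphism of schemes all of whose base changes are homeomorphisms. -/
def IsUniversalHomeomorphism {X Y : Scheme.{u}} (f : X ⟶ Y) : Prop :=
  MorphismProperty.universally (topologically (IsHomeomorph ·)) f

/-- A group scheme over a field is infinitesimal if it is finite and has only one point (which is
then the image of the unit section). -/
def IsInfinitesimal {k : Type u} [Field k] (G : Grp (Over (Spec (.of k)))) : Prop :=
  IsFinite G.X.hom ∧ Subsingleton G.X.left

/-- A group scheme over a field is pro-infinitesimal if it is the limit of a cofiltered system of
infinitesimal group schemes. -/
def IsProInfinitesimal {k : Type u} [Field k] (G : Grp (Over (Spec (.of k)))) : Prop :=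
  ∃ (J : Type u) (_ : SmallCategory J) (_ : IsCofiltered J)
    (F : J ⥤ Grp (Over (Spec (.of k)))) (c : Cone F),
    (∀ j, IsInfinitesimal (F.obj j)) ∧ Nonempty (IsLimit c) ∧ Nonempty (c.pt ≅ G)

end RamifiedWitt

end

/-! Everything rests on one congruence. Since `K'/K` is unramified, `π` is also a uniformizer of
`O'`. For the choice `ϖ = π`, the `n`-th component of Drinfeld's morphism is congruent to `X_n ^
q^(n(r-1))` modulo `π` (`dvd_drinfeldPoly_sub`). Indeed, modulo `π^(n+1)` only the terms `π^j
X_j^(q^(rn-j))` with `j ≤ n` of `Φ_{rn}` survive. They form the Witt polynomial `Φ'_n` evaluated at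
the powers `X_j ^ q^(j(r-1))`, because `rn - j = j(r-1) + r(n-j)`.

For arbitrary `ϖ`, the two systems of Witt polynomials over `O'` are related by an invertible change
of coordinates that fixes the zero sequence (`changePoly`). Hence `u_{k'}` is the coordinatewise map
`X_i ↦ X_i ^ q^(i(r-1))` followed by an automorphism of the affine space.

On rings this map is injective, and every polynomial has a `p`-power in the image. So `u_{k'}` is
integral, surjective and universally injective, hence a universal homeomorphism
(`isUniversalHomeomorphism_SpecMap`).

The kernel is cut out by `X_i ^ q^(i(r-1)) = 0` (`comp_drinfeldSpecialFiber_eq_one_iff`,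
`exists_iso_kernel_drinfeldSpecialFiber`). Witt vector addition is triangular: the `n`-th coordinate
of a sum depends only on coordinates of index at most `n` (`aeval_addPoly_congr`). So keeping the
first `N` coordinates defines a quotient group of the kernel. These quotients are finite with one
point, and the kernel is their limit (`isProInfinitesimal_of_iso_powScheme`). -/

noncomputable section

set_option linter.unusedSectionVars false

namespace RamifiedWitt
open MvPolynomial

/-! ### Finite-level uniqueness for Witt polynomials -/

section Ghost

/-- The system of Witt polynomials is triangular, so its first `m + 1` equations already determine
the first `m + 1` entries. This finite form is what shows which variables the addition polynomials
involve. -/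
lemma ghost_injective_of_le {B : Type*} [CommRing B] {ϖ : B} (hϖ : IsLeftRegular ϖ) (Q : ℕ)
    {b c : ℕ → B} {m : ℕ} (h : ∀ n ≤ m, ghost ϖ Q n b = ghost ϖ Q n c) {n : ℕ} (hn : n ≤ m) :
    b n = c n := by
  induction n using Nat.strong_induction_on with
  | _ n ih =>
    have h1 := h n hn
    unfold ghost at h1
    rw [Finset.sum_range_succ, Finset.sum_range_succ,
      Finset.sum_congr rfl fun i hi ↦ by
        rw [ih i (Finset.mem_range.1 hi) ((Finset.mem_range.1 hi).le.trans hn)]] at h1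
    simpa using (hϖ.pow n) (by simpa using h1)

lemma ghost_congr_of_le {B : Type*} [CommRing B] (ϖ : B) (Q : ℕ) {b c : ℕ → B} {n : ℕ}
    (h : ∀ i ≤ n, b i = c i) : ghost ϖ Q n b = ghost ϖ Q n c :=
  Finset.sum_congr rfl fun i hi ↦ by rw [h i (Nat.lt_succ_iff.1 (Finset.mem_range.1 hi))]

lemma map_ghost_aeval {R S ι : Type*} [CommRing R] [CommRing S] [Algebra R S] (ϖ : R) (Q n : ℕ)
    (v : ι → S) (b : ℕ → MvPolynomial ι R) :
    aeval v (ghost (C ϖ) Q n b) = ghost (algebraMap R S ϖ) Q n (fun i ↦ aeval v (b i)) := by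
  simpa using map_ghost (aeval v : MvPolynomial ι R →ₐ[R] S).toRingHom (C ϖ) Q n b

lemma isLeftRegular_C {R ι : Type*} [CommRing R] [IsDomain R] {ϖ : R} (hϖ : ϖ ≠ 0) :
    IsLeftRegular (C ϖ : MvPolynomial ι R) :=
  IsLeftCancelMulZero.mul_left_cancel_of_ne_zero (by simpa using hϖ)

end Ghost

/-! ### Triangularity of Witt vector addition -/

section AddPoly

variable {O : Type u} [CommRing O] [IsDomain O] [IsDiscreteValuationRing O] {π : O}
  [Finite (IsLocalRing.ResidueField O)]

/-- The `n`-th addition polynomial only involves variables of index at most `n`. -/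
lemma aeval_addPoly_congr (hπ : Irreducible π) {B : Type*} [CommRing B] [Algebra O B]
    {a a' b b' : ℕ → B} {n : ℕ} (ha : ∀ i ≤ n, a i = a' i) (hb : ∀ i ≤ n, b i = b' i) :
    aeval (Sum.elim a b) (addPoly π n) = aeval (Sum.elim a' b') (addPoly π n) := by
  -- `ρ` kills the variables of index above `n`. Witt polynomials of index at most `n` do not see
  -- them, so by uniqueness over the polynomial ring `ρ` fixes `addPoly π n`. The statement then
  -- specializes to any `B`, where uniqueness itself may fail.
  let ρ : ℕ ⊕ ℕ → MvPolynomial (ℕ ⊕ ℕ) O :=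
    Sum.elim (fun i ↦ if i ≤ n then X (Sum.inl i) else 0) fun i ↦ if i ≤ n then X (Sum.inr i) else 0
  have h1 : aeval ρ (addPoly π n) = addPoly π n := by
    refine ghost_injective_of_le (isLeftRegular_C hπ.ne_zero) (resCard O)
      (b := fun i ↦ aeval ρ (addPoly π i)) (m := n) (fun m hm ↦ ?_) le_rfl
    refine (map_ghost_aeval π _ m ρ (addPoly π)).symm.trans ?_
    rw [WittVec.ghost_addPoly hπ, map_add, map_ghost_aeval, map_ghost_aeval]
    congr 1 <;> exact ghost_congr_of_le _ _ fun i hi ↦ by simp [ρ, hi.trans hm]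
  have h2 (a b : ℕ → B) : aeval (Sum.elim a b) (addPoly π n) =
      aeval (Sum.elim (fun i ↦ if i ≤ n then a i else 0) fun i ↦ if i ≤ n then b i else 0)
        (addPoly π n) := by
    conv_lhs => rw [← h1]
    rw [← AlgHom.comp_apply, comp_aeval]
    congr 2
    funext i
    rcases i with i | i <;> by_cases hi : i ≤ n <;> simp [ρ, hi]
  rw [h2 a b, h2 a' b']
  congr 3 <;> funext i <;> split_ifs with hi
  exacts [ha i hi, rfl, hb i hi, rfl]

end AddPoly

/-! ### Comparison of Witt vectors for two uniformizers of the same ring -/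

section ChangeOfUniformizer

variable {O : Type u} [CommRing O] [IsDomain O] [IsDiscreteValuationRing O]
  [Finite (IsLocalRing.ResidueField O)] {π ϖ : O}

variable (π ϖ) in
/-- The polynomials whose Witt polynomials with respect to `ϖ` are the Witt polynomials of the
variables with respect to `π`. -/
def changePoly : ℕ → MvPolynomial ℕ O :=
  solve (C ϖ) (resCard O) fun n ↦ ghost (C π) (resCard O) n X

/-- Two uniformizers are associated, so the congruences modulo `π^(n+1)` satisfied by the Witt
polynomials for `π` are exactly those that Dwork's lemma requires for `ϖ`. -/
lemma ghost_changePoly (hπ : Irreducible π) (hϖ : Irreducible ϖ) (n : ℕ) :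
    ghost (C ϖ) (resCard O) n (changePoly π ϖ) = ghost (C π) (resCard O) n X := by
  refine ghost_solve_mvPolynomial hϖ (fun n ↦ ?_) n
  refine dvd_trans (pow_dvd_pow_of_dvd (map_dvd C ?_) _)
    (WittVec.dvd_expand_ghost (π := π) (fun i ↦ i) n)
  exact (IsDiscreteValuationRing.associated_of_irreducible O hϖ hπ).dvd

/-- Both sides have the same Witt polynomials with respect to `π`. Exchanging the uniformizers gives
the inverse in the other order, so the change of coordinates is invertible. -/
lemma aeval_changePoly_changePoly (hπ : Irreducible π) (hϖ : Irreducible ϖ) (n : ℕ) :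
    aeval (changePoly π ϖ) (changePoly ϖ π n) = X n := by
  refine congrFun (ghost_injective (isLeftRegular_C hπ.ne_zero) (resCard O)
    (b := fun i ↦ aeval (changePoly π ϖ) (changePoly ϖ π i)) (c := X) fun m ↦ ?_) n
  refine (map_ghost_aeval π _ m _ _).symm.trans ?_
  rw [ghost_changePoly hϖ hπ, map_ghost_aeval]
  simp only [aeval_X]
  exact ghost_changePoly hπ hϖ m

lemma ghost_zero_fun {B : Type*} [CommRing B] (ϖ : B) {Q : ℕ} (hQ : Q ≠ 0) (n : ℕ) :
    ghost ϖ Q n 0 = 0 :=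
  Finset.sum_eq_zero fun i _ ↦ by simp [zero_pow (pow_ne_zero _ hQ)]

lemma aeval_zero_changePoly (hπ : Irreducible π) (hϖ : Irreducible ϖ) {B : Type*} [CommRing B]
    [Algebra O B] (n : ℕ) : aeval (0 : ℕ → B) (changePoly π ϖ n) = 0 := by
  -- Witt polynomials determine a sequence over `O`, where `ϖ` is regular, but not over `B`, where
  -- `ϖ` may be zero. The vanishing is proved over `O` and then transported.
  have h : aeval (0 : ℕ → O) (changePoly π ϖ n) = 0 := by
    refine congrFun (ghost_injective (ϖ := ϖ)
      (IsLeftCancelMulZero.mul_left_cancel_of_ne_zero hϖ.ne_zero) (resCard O)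
      (b := fun i ↦ aeval (0 : ℕ → O) (changePoly π ϖ i)) (c := 0) fun m ↦ ?_) n
    refine (map_ghost_aeval ϖ _ m _ _).symm.trans ?_
    rw [ghost_changePoly hπ hϖ, map_ghost_aeval, ghost_zero_fun _ WittVec.resCard_ne_zero]
    simp only [aeval_X]
    exact ghost_zero_fun _ WittVec.resCard_ne_zero _
  have h2 := (aeval_algebraMap_apply B (0 : ℕ → O) (changePoly π ϖ n))
  rw [h, map_zero] at h2
  rw [← h2]
  congr 2
  funext i
  exact (map_zero _).symm

end ChangeOfUniformizer

/-! ### Drinfeld's polynomials modulo the uniformizer -/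

section Drinfeld

variable {O : Type u} [CommRing O] [IsDomain O] [IsDiscreteValuationRing O]
  [Finite (IsLocalRing.ResidueField O)] {O' : Type u} [CommRing O'] [IsDomain O']
  [IsDiscreteValuationRing O'] [Finite (IsLocalRing.ResidueField O')] [Algebra O O']
  [Module.Finite O O'] [FaithfulSMul O O'] {π : O} {ϖ : O'}

/-- Reduces an arbitrary uniformizer of `O'` to the case of `π`: both sequences have the Witt
polynomials `Φ_{rn}` with respect to `ϖ`. -/
lemma aeval_drinfeldPoly_changePoly (hπ : Irreducible π) (hπ' : Irreducible (algebraMap O O' π))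
    (hϖ : Irreducible ϖ) {r : ℕ} (hr : resCard O' = resCard O ^ r) (n : ℕ) :
    aeval (drinfeldPoly π (algebraMap O O' π) r) (changePoly (algebraMap O O' π) ϖ n) =
      drinfeldPoly π ϖ r n := by
  refine congrFun (ghost_injective (isLeftRegular_C hϖ.ne_zero) (resCard O')
    (b := fun i ↦ aeval (drinfeldPoly π (algebraMap O O' π) r)
      (changePoly (algebraMap O O' π) ϖ i)) (c := drinfeldPoly π ϖ r) fun m ↦ ?_) n
  refine (map_ghost_aeval ϖ _ m _ _).symm.trans ?_
  rw [ghost_changePoly hπ' hϖ, map_ghost_aeval, ghost_drinfeldPoly hπ hϖ hr]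
  simp only [aeval_X]
  exact ghost_drinfeldPoly hπ hπ' hr m

/-- The central congruence. Modulo `π^(n+1)`, the truncation of `Φ_{rn}` at index `n` is `Φ'_n`
evaluated at the powers `X_j ^ q^(j(r-1))`. By induction the terms of index below `n` agree modulo
`π^(n+1)`, which leaves `π^n` times the difference sought. -/
lemma dvd_drinfeldPoly_sub (hπ : Irreducible π) (hπ' : Irreducible (algebraMap O O' π))
    {r : ℕ} (hr : resCard O' = resCard O ^ r) (n : ℕ) :
    C (algebraMap O O' π) ∣ drinfeldPoly π (algebraMap O O' π) r n -
      X n ^ resCard O ^ (n * (r - 1)) := by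
  have hr0 := ne_zero_of_resCard_eq hr
  have hQ : (C (algebraMap O O' π) : MvPolynomial ℕ O') ∣ (resCard O' : MvPolynomial ℕ O') := by
    rw [← map_natCast (C : O' →+* MvPolynomial ℕ O')]
    exact map_dvd _ (dvd_resCard hπ')
  induction n using Nat.strong_induction_on with
  | _ n ih =>
    set w := drinfeldPoly π (algebraMap O O' π) r
    set p : MvPolynomial ℕ O' := C (algebraMap O O' π)
    have hle : n ≤ r * n := Nat.le_mul_of_pos_left n (Nat.pos_of_ne_zero hr0)
    have hp : ∀ m, IsLeftRegular (p ^ m) := fun m ↦ (isLeftRegular_C hπ'.ne_zero).pow m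
    have h := ghost_drinfeldPoly hπ hπ' hr n
    change ghost p (resCard O') n w = ghost p (resCard O) (r * n) X at h
    -- The exponents match because `j(r-1) + r(n-j) = rn - j`.
    have e : ∀ j ≤ n, (X j ^ resCard O ^ (j * (r - 1)) : MvPolynomial ℕ O') ^ resCard O' ^ (n - j) =
        X j ^ resCard O ^ (r * n - j) := fun j hj ↦ by
      rw [hr, ← pow_mul, ← pow_mul, ← pow_add]
      congr 2
      obtain ⟨r, rfl⟩ := Nat.exists_eq_succ_of_ne_zero hr0
      obtain ⟨d, rfl⟩ := Nat.exists_eq_add_of_le hj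
      simp only [Nat.succ_eq_add_one, add_tsub_cancel_right, add_tsub_cancel_left]
      refine (Nat.sub_eq_of_eq_add ?_).symm
      ring
    have h1 : p ^ (n + 1) ∣ ghost p (resCard O) (r * n) X -
        ∑ j ∈ Finset.range (n + 1), p ^ j * X j ^ resCard O ^ (r * n - j) := by
      unfold ghost
      rw [← Finset.sum_range_add_sum_Ico _ (Nat.succ_le_succ hle), add_sub_cancel_left]
      exact Finset.dvd_sum fun i hi ↦ (pow_dvd_pow _ (Finset.mem_Ico.1 hi).1).mul_right _
    -- A congruence modulo `p` becomes one modulo `p^(n-j+1)` after raising to the power `Q^(n-j)`,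
    -- with `Q = resCard O'`; the factor `p^j` supplies the rest.
    have h2 : p ^ (n + 1) ∣ ∑ j ∈ Finset.range n, (p ^ j * w j ^ resCard O' ^ (n - j) -
        p ^ j * X j ^ resCard O ^ (r * n - j)) := by
      refine Finset.dvd_sum fun j hj ↦ ?_
      have hj' := Finset.mem_range.1 hj
      rw [← e j hj'.le, ← mul_sub, show n + 1 = j + ((n - j) + 1) by omega, pow_add]
      exact mul_dvd_mul_left _ (dvd_pow_sub_pow hQ (ih j hj') _)
    rw [← h, ghost, Finset.sum_range_succ, Finset.sum_range_succ, ← e n le_rfl] at h1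
    rw [Finset.sum_sub_distrib] at h2
    have h3 := dvd_sub h1 h2
    obtain ⟨c, hc⟩ := h3
    -- The difference is `p^n` times the desired quantity and is divisible by `p^(n+1)`; `p^n` is
    -- regular and can be cancelled.
    refine ⟨c, hp n ?_⟩
    simp only [tsub_self, pow_zero, pow_one] at hc
    change p ^ n * _ = p ^ n * _
    rw [← mul_assoc, ← pow_succ, ← hc]
    ring

variable [Algebra.Unramified O O']

/-- In an unramified extension the maximal ideal of `O` generates that of `O'`. -/
lemma irreducible_algebraMap (hπ : Irreducible π) : Irreducible (algebraMap O O' π) := by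
  have : IsLocalHom (algebraMap O O') := inferInstance
  rw [IsDiscreteValuationRing.irreducible_iff_uniformizer]
  have h := Algebra.FormallyUnramified.map_maximalIdeal (R := O) (S := O')
  rw [← h, hπ.maximalIdeal_eq, Ideal.map_span, Set.image_singleton]

end Drinfeld
end RamifiedWitt

namespace RamifiedWitt
open MvPolynomial

lemma aeval_aeval_changePoly {O : Type u} [CommRing O] [IsDomain O] [IsDiscreteValuationRing O]
    [Finite (IsLocalRing.ResidueField O)] {π ϖ : O} (hπ : Irreducible π) (hϖ : Irreducible ϖ)
    {B : Type*} [CommRing B] [Algebra O B] (b : ℕ → B) (n : ℕ) :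
    aeval (fun i ↦ aeval b (changePoly π ϖ i)) (changePoly ϖ π n) = b n := by
  rw [← comp_aeval, AlgHom.comp_apply, aeval_changePoly_changePoly hπ hϖ, aeval_X]

/-! ### Drinfeld's map over the residue field, at the level of rings -/

section Drinfeld

variable {O : Type u} [CommRing O] [IsDomain O] [IsDiscreteValuationRing O]
  [Finite (IsLocalRing.ResidueField O)] {O' : Type u} [CommRing O'] [IsDomain O']
  [IsDiscreteValuationRing O'] [Finite (IsLocalRing.ResidueField O')] [Algebra O O']
  [Module.Finite O O'] [FaithfulSMul O O'] [Algebra.Unramified O O'] {π : O} {ϖ : O'}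

/-- In coefficients killed by the uniformizer, Drinfeld's morphism is the composition of a
Frobenius power in each variable and the change of uniformizers. -/
lemma aeval_drinfeldPoly (hπ : Irreducible π) (hϖ : Irreducible ϖ) {r : ℕ}
    (hr : resCard O' = resCard O ^ r) {B : Type*} [CommRing B] [Algebra O' B]
    (hB : algebraMap O' B ϖ = 0) (a : ℕ → B) (n : ℕ) :
    aeval a (drinfeldPoly π ϖ r n) =
      aeval (fun i ↦ a i ^ resCard O ^ (i * (r - 1))) (changePoly (algebraMap O O' π) ϖ n) := by
  have hπ' := irreducible_algebraMap (O' := O') hπ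
  have hB' : algebraMap O' B (algebraMap O O' π) = 0 := by
    obtain ⟨c, hc⟩ := (IsDiscreteValuationRing.associated_of_irreducible O' hϖ hπ').dvd
    rw [hc, map_mul, hB, zero_mul]
  rw [← aeval_drinfeldPoly_changePoly hπ hπ' hϖ hr, ← AlgHom.comp_apply, comp_aeval]
  congr 2
  funext i
  obtain ⟨c, hc⟩ := dvd_drinfeldPoly_sub hπ hπ' hr i
  have h := congrArg (aeval a) hc
  rw [map_mul, aeval_C, hB', zero_mul, map_sub, map_pow, aeval_X, sub_eq_zero] at h
  exact h

/-- The change of uniformizer is invertible and both it and its inverse send zero to zero, so only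
the coordinatewise powers matter for the kernel. -/
lemma aeval_drinfeldPoly_eq_zero_iff (hπ : Irreducible π) (hϖ : Irreducible ϖ) {r : ℕ}
    (hr : resCard O' = resCard O ^ r) {B : Type*} [CommRing B] [Algebra O' B]
    (hB : algebraMap O' B ϖ = 0) (a : ℕ → B) :
    (∀ n, aeval a (drinfeldPoly π ϖ r n) = 0) ↔ ∀ n, a n ^ resCard O ^ (n * (r - 1)) = 0 := by
  have hπ' := irreducible_algebraMap (O' := O') hπ
  simp only [aeval_drinfeldPoly hπ hϖ hr hB]
  set b : ℕ → B := fun i ↦ a i ^ resCard O ^ (i * (r - 1))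
  refine ⟨fun h n ↦ ?_, fun h n ↦ ?_⟩
  · change b n = 0
    rw [← aeval_aeval_changePoly hπ' hϖ b n, funext h]
    exact aeval_zero_changePoly hϖ hπ' n
  · rw [show b = 0 from funext h]
    exact aeval_zero_changePoly hπ' hϖ n

variable (O') in
/-- The endomorphism of `k[X₀, X₁, …]` given by the reduction of a sequence of polynomials over
`O'` with residue field `k`. -/
def reduction (t : ℕ → MvPolynomial ℕ O') : MvPolynomial ℕ (IsLocalRing.ResidueField O') →ₐ[
    IsLocalRing.ResidueField O'] MvPolynomial ℕ (IsLocalRing.ResidueField O') :=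
  aeval fun n ↦ aeval X (t n)

lemma aeval_reduction_X {B : Type*} [CommRing B] [Algebra O' B]
    [Algebra (IsLocalRing.ResidueField O') B] [IsScalarTower O' (IsLocalRing.ResidueField O') B]
    (t : ℕ → MvPolynomial ℕ O') (v : ℕ → B) (n : ℕ) :
    aeval v (reduction O' t (X n)) = aeval v (t n) := by
  rw [reduction, aeval_X, ← AlgHom.restrictScalars_apply O', ← AlgHom.comp_apply, comp_aeval]
  simp

lemma reduction_changePoly_comp {ϖ' : O'} (hϖ' : Irreducible ϖ') (hϖ : Irreducible ϖ) :
    (reduction O' (changePoly ϖ' ϖ)).comp (reduction O' (changePoly ϖ ϖ')) = .id _ _ := by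
  refine algHom_ext fun n ↦ ?_
  rw [AlgHom.comp_apply, reduction, aeval_reduction_X, aeval_aeval_changePoly hϖ' hϖ]
  rfl

lemma reduction_changePoly_bijective {ϖ' : O'} (hϖ' : Irreducible ϖ') (hϖ : Irreducible ϖ) :
    Function.Bijective (reduction O' (changePoly ϖ' ϖ)) :=
  Function.bijective_iff_has_inverse.2 ⟨reduction O' (changePoly ϖ ϖ'),
    AlgHom.congr_fun (reduction_changePoly_comp hϖ hϖ'),
    AlgHom.congr_fun (reduction_changePoly_comp hϖ' hϖ)⟩

lemma algebraMap_residue_eq_zero (hϖ : Irreducible ϖ) :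
    algebraMap O' (IsLocalRing.ResidueField O') ϖ = 0 :=
  (dvd_iff_residue hϖ ϖ).1 dvd_rfl

/-- This is `aeval_drinfeldPoly` at the universal point `X`, whose coefficients lie in an algebra
over the residue field. -/
lemma reduction_drinfeldPoly (hπ : Irreducible π) (hϖ : Irreducible ϖ) {r : ℕ}
    (hr : resCard O' = resCard O ^ r) :
    reduction O' (drinfeldPoly π ϖ r) = (aeval fun i ↦ X i ^ resCard O ^ (i * (r - 1))).comp
      (reduction O' (changePoly (algebraMap O O' π) ϖ)) := by
  refine algHom_ext fun n ↦ ?_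
  rw [AlgHom.comp_apply, aeval_reduction_X, ← aeval_drinfeldPoly hπ hϖ hr, reduction, aeval_X]
  rw [IsScalarTower.algebraMap_apply O' (IsLocalRing.ResidueField O'),
    algebraMap_residue_eq_zero hϖ, map_zero]

/-- Injectivity means that the powers `X_i ^ e_i` are algebraically independent. They are, since
each is a transcendental polynomial in its own variable. -/
lemma aeval_X_pow_injective {k ι : Type*} [Field k] (e : ι → ℕ) (he : ∀ i, e i ≠ 0) :
    Function.Injective (aeval fun i ↦ X i ^ e i : MvPolynomial ι k →ₐ[k] MvPolynomial ι k) := by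
  have := algebraicIndependent_polynomial_aeval_X (ι := ι) (R := k) (fun i ↦ Polynomial.X ^ e i)
    fun i ↦ (Polynomial.transcendental_X k).pow (Nat.pos_of_ne_zero (he i))
  simpa [AlgebraicIndependent] using this

/-- Raising to a `p`-power is additive, so it suffices to treat constants and variables. The
exponent `N` depends on the finitely many variables in `f`, since `m` may be unbounded. -/
lemma exists_pow_mem_range_aeval_X_pow {k ι : Type*} [Field k] (p : ℕ) [ExpChar k p] (m : ι → ℕ)
    (f : MvPolynomial ι k) :
    ∃ N, f ^ p ^ N ∈
      (aeval fun i ↦ X i ^ p ^ m i : MvPolynomial ι k →ₐ[k] MvPolynomial ι k).range := by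
  have mono (A : Subalgebra k (MvPolynomial ι k)) {x : MvPolynomial ι k} {N M : ℕ}
      (h : x ^ p ^ N ∈ A) (hNM : N ≤ M) : x ^ p ^ M ∈ A := by
    obtain ⟨d, rfl⟩ := Nat.exists_eq_add_of_le hNM
    rw [pow_add, pow_mul]
    exact pow_mem h _
  induction f using MvPolynomial.induction_on with
  | C a => exact ⟨0, C a, by simp⟩
  | add f g hf hg =>
    obtain ⟨N, hN⟩ := hf
    obtain ⟨M, hM⟩ := hg
    refine ⟨max N M, ?_⟩
    rw [add_pow_expChar_pow]
    exact add_mem (mono _ hN (le_max_left _ _)) (mono _ hM (le_max_right _ _))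
  | mul_X f i hf =>
    obtain ⟨N, hN⟩ := hf
    refine ⟨max N (m i), ?_⟩
    rw [mul_pow]
    exact mul_mem (mono _ hN (le_max_left _ _))
      (mono _ (N := m i) ⟨X i, by simp⟩ (le_max_right _ _))

lemma reduction_drinfeldPoly_injective (hπ : Irreducible π) (hϖ : Irreducible ϖ) {r : ℕ}
    (hr : resCard O' = resCard O ^ r) :
    Function.Injective (reduction O' (drinfeldPoly π ϖ r)) := by
  rw [reduction_drinfeldPoly hπ hϖ hr, AlgHom.coe_comp]
  exact Function.Injective.comp
    (aeval_X_pow_injective _ fun i ↦ pow_ne_zero _ WittVec.resCard_ne_zero)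
    (reduction_changePoly_bijective (irreducible_algebraMap hπ) hϖ).1

lemma exists_pow_mem_range_reduction_drinfeldPoly (hπ : Irreducible π) (hϖ : Irreducible ϖ) {r : ℕ}
    (hr : resCard O' = resCard O ^ r) (p : ℕ) [ExpChar (IsLocalRing.ResidueField O') p] {h : ℕ}
    (hq : resCard O = p ^ h) (f : MvPolynomial ℕ (IsLocalRing.ResidueField O')) :
    ∃ N, f ^ p ^ N ∈ (reduction O' (drinfeldPoly π ϖ r)).range := by
  obtain ⟨N, g, hg⟩ := exists_pow_mem_range_aeval_X_pow p (fun i ↦ h * (i * (r - 1))) f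
  -- The change of uniformizer is an automorphism, so composing with it does not alter the image.
  obtain ⟨g, rfl⟩ := (reduction_changePoly_bijective (irreducible_algebraMap hπ) hϖ).2 g
  refine ⟨N, g, ?_⟩
  simp only [reduction_drinfeldPoly hπ hϖ hr, hq, ← pow_mul]
  exact hg

end Drinfeld
end RamifiedWitt

/-! ### A criterion for universal homeomorphisms -/

namespace RamifiedWitt
open AlgebraicGeometry CategoryTheory Limits MorphismProperty

/-- All three properties are stable under base change, and integral morphisms are closed. Every base
change is therefore a continuous closed bijection. -/
lemma isUniversalHomeomorphism_of_isIntegralHom {X Y : Scheme.{u}} (f : X ⟶ Y) [IsIntegralHom f]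
    [Surjective f] [UniversallyInjective f] : IsUniversalHomeomorphism f := by
  intro X' Y' i₁ i₂ f' h
  have h1 : IsIntegralHom f' := MorphismProperty.of_isPullback h.flip ‹_›
  have h2 : Surjective f' := MorphismProperty.of_isPullback h.flip ‹_›
  have h3 : UniversallyInjective f' := MorphismProperty.of_isPullback h.flip ‹_›
  exact isHomeomorph_iff_continuous_isClosedMap_bijective.2
    ⟨f'.continuous, f'.isClosedMap, f'.injective, f'.surjective⟩

lemma IsUniversalHomeomorphism.of_arrow_iso {X Y X' Y' : Scheme.{u}} {f : X ⟶ Y} {f' : X' ⟶ Y'}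
    (e : CategoryTheory.Arrow.mk f ≅ CategoryTheory.Arrow.mk f') (hf : IsUniversalHomeomorphism f) :
    IsUniversalHomeomorphism f' :=
  (MorphismProperty.arrow_mk_iso_iff (MorphismProperty.universally _) e).1 hf

/-- An injective homomorphism of algebras over a field of exponential characteristic `p` such that
every element of the target has a `p`-power in the image induces a universal homeomorphism. -/
lemma isUniversalHomeomorphism_SpecMap {k A B : Type u} [Field k] (p : ℕ) [ExpChar k p]
    [CommRing A] [CommRing B] [Algebra k A] [Algebra k B] (f : A →ₐ[k] B)
    (hf : Function.Injective f) (hfp : ∀ b, ∃ N, b ^ p ^ N ∈ f.range) :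
    IsUniversalHomeomorphism (Spec.map (CommRingCat.ofHom f.toRingHom)) := by
  have hp : 0 < p := expChar_pos k p
  have hint : f.toRingHom.IsIntegral := fun b ↦ by
    obtain ⟨N, a, ha⟩ := hfp b
    refine ⟨Polynomial.X ^ p ^ N - Polynomial.C a,
      Polynomial.monic_X_pow_sub_C a (by positivity), ?_⟩
    simpa [sub_eq_zero] using ha.symm
  have h1 : IsIntegralHom (Spec.map (CommRingCat.ofHom f.toRingHom)) :=
    IsIntegralHom.SpecMap_iff.2 hint
  have h2 : Surjective (Spec.map (CommRingCat.ofHom f.toRingHom)) :=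
    ⟨hint.comap_surjective hf⟩
  have h3 : UniversallyInjective (Spec.map (CommRingCat.ofHom f.toRingHom)) := by
    -- Universal injectivity is tested on points in fields `K`. Two `K`-points that agree on `A`
    -- agree on some `b ^ p ^ N` for each `b`, hence on `b`, as Frobenius is injective on `K`.
    suffices key : ∀ (K : Type u) [Field K], Function.Injective fun g : Spec (.of K) ⟶ Spec (.of B) ↦
        g ≫ Spec.map (CommRingCat.ofHom f.toRingHom) from
      ((tfae_universallyInjective _).out 0 1).2 key
    intro K _ g₁ g₂ h
    obtain ⟨g₁, rfl⟩ := Spec.map_surjective g₁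
    obtain ⟨g₂, rfl⟩ := Spec.map_surjective g₂
    simp only [← Spec.map_comp] at h
    have h := Spec.map_injective h
    have h' (a : A) : g₁.hom (f a) = g₂.hom (f a) := ConcreteCategory.congr_hom h a
    have : ExpChar K p :=
      expChar_of_injective_ringHom (g₁.hom.comp (algebraMap k B)).injective p
    congr 1
    ext b
    obtain ⟨N, a, ha⟩ := hfp b
    refine iterateFrobenius_inj K p N ?_
    have ha : f a = b ^ p ^ N := ha
    simp only [iterateFrobenius_def, ← map_pow, ← ha, h']
  exact isUniversalHomeomorphism_of_isIntegralHom _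

end RamifiedWitt

namespace RamifiedWitt
open CategoryTheory Limits Opposite MonoidalCategory CartesianMonoidalCategory MonObj

/-! ### Towers of quotient groups with set-theoretic sections -/

section Retract

variable {C : Type*} [Category.{v} C] [CartesianMonoidalCategory C] {G Z : C} [GrpObj G]
  {p : G ⟶ Z} {s : Z ⟶ G}

variable (p s) in
/-- A retract of a group object whose retraction is compatible with multiplication. -/
structure IsGroupRetract : Prop where
  s_p : s ≫ p = 𝟙 Z
  mul_congr ⦃T : C⦄ ⦃a a' b b' : T ⟶ G⦄ : a ≫ p = a' ≫ p → b ≫ p = b' ≫ p →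
    (a * b) ≫ p = (a' * b') ≫ p

namespace IsGroupRetract

variable (h : IsGroupRetract p s)

include h

lemma comp_s_p {T : C} (x : T ⟶ Z) : (x ≫ s) ≫ p = x := by
  rw [Category.assoc, h.s_p, Category.comp_id]

/-- The group structure on the points of a group retract. -/
abbrev group (T : C) : Group (T ⟶ Z) :=
  letI : Mul (T ⟶ Z) := ⟨fun x y ↦ ((x ≫ s) * (y ≫ s)) ≫ p⟩
  letI : One (T ⟶ Z) := ⟨(1 : T ⟶ G) ≫ p⟩
  letI : Inv (T ⟶ Z) := ⟨fun x ↦ (x ≫ s)⁻¹ ≫ p⟩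
  Group.ofLeftAxioms
    -- Each axiom is that of `G` followed by `p`. By `mul_congr`, an intermediate `(… ≫ p) ≫ s`
    -- inside a product may be replaced by the original point, although `s` need not be a
    -- homomorphism.
    (fun x y z ↦ (h.mul_congr (h.comp_s_p _) rfl).trans
      ((congrArg (· ≫ p) (mul_assoc (x ≫ s) (y ≫ s) (z ≫ s))).trans
        (h.mul_congr rfl (h.comp_s_p _).symm)))
    (fun x ↦ (h.mul_congr (h.comp_s_p _) rfl).trans
      ((congrArg (· ≫ p) (one_mul (x ≫ s))).trans (h.comp_s_p x)))
    (fun x ↦ (h.mul_congr (h.comp_s_p _) rfl).trans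
      (congrArg (· ≫ p) (inv_mul_cancel (x ≫ s))))

/-- The presheaf of groups of points of a group retract. -/
def presheaf : Cᵒᵖ ⥤ GrpCat.{v} where
  obj T := letI := h.group T.unop; GrpCat.of (T.unop ⟶ Z)
  map {T T'} f :=
    letI := h.group T.unop
    letI := h.group T'.unop
    GrpCat.ofHom
    { toFun x := f.unop ≫ x
      map_one' := by
        change f.unop ≫ (1 : T.unop ⟶ G) ≫ p = (1 : T'.unop ⟶ G) ≫ p
        rw [← Category.assoc, comp_one]
      map_mul' x y := by
        change f.unop ≫ ((x ≫ s) * (y ≫ s)) ≫ p = (((f.unop ≫ x) ≫ s) * ((f.unop ≫ y) ≫ s)) ≫ p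
        rw [← Category.assoc, comp_mul, Category.assoc, Category.assoc] }
  map_id T :=
    letI := h.group T.unop
    GrpCat.hom_ext <| MonoidHom.ext fun x ↦ Category.id_comp x
  map_comp {T _ T'} f g :=
    letI := h.group T.unop
    letI := h.group T'.unop
    GrpCat.hom_ext <| MonoidHom.ext fun x ↦ Category.assoc _ _ x

/-- A group retract represents its presheaf of groups of points. -/
def representableBy : (h.presheaf ⋙ forget GrpCat).RepresentableBy Z where
  homEquiv := .refl _
  homEquiv_comp _ _ := rfl

/-- The group object structure on a group retract. -/
abbrev grpObj : GrpObj Z := GrpObj.ofRepresentableBy _ _ h.representableBy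

lemma mul_eq {T : C} (x y : T ⟶ Z) :
    letI := h.grpObj
    x * y = ((x ≫ s) * (y ≫ s)) ≫ p :=
  ((yonedaGrpObjIsoOfRepresentableBy _ _ h.representableBy).hom.app (op T)).hom.map_mul x y

lemma mul_comp {T : C} (a b : T ⟶ G) :
    letI := h.grpObj
    (a * b) ≫ p = (a ≫ p) * (b ≫ p) :=
  (h.mul_congr (h.comp_s_p _).symm (h.comp_s_p _).symm).trans (h.mul_eq _ _).symm

end IsGroupRetract

/-- A group object is the limit of a tower of group retracts, if it is so as an object. -/
lemma exists_limit_of_isGroupRetract {C : Type*} [Category.{v} C] [CartesianMonoidalCategory C]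
    (G : Grp C) (Z : ℕ → C) (p : ∀ n, G.X ⟶ Z n) (s : ∀ n, Z n ⟶ G.X)
    (h : ∀ n, IsGroupRetract (p n) (s n)) (hps : ∀ m n, m ≤ n → p n ≫ s n ≫ p m = p m)
    (hlim : ∀ (T : C) (x : ∀ n, T ⟶ Z n), (∀ m n, m ≤ n → x n ≫ s n ≫ p m = x m) →
      ∃ f : T ⟶ G.X, ∀ n, f ≫ p n = x n)
    (hext : ∀ (T : C) (f g : T ⟶ G.X), (∀ n, f ≫ p n = g ≫ p n) → f = g) :
    ∃ F : (ULift.{u} ℕ)ᵒᵖ ⥤ Grp C, ∃ c : Cone F,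
      (∀ j, (F.obj j).X = Z j.unop.down) ∧ Nonempty (IsLimit c) ∧ Nonempty (c.pt ≅ G) := by
  let instZ : ∀ n, GrpObj (Z n) := fun n ↦ (h n).grpObj
  have hp : ∀ n, IsMonHom (p n) := fun n ↦ isMonHom_of_map_mul _ fun T a b ↦ (h n).mul_comp a b
  let P (n : ℕ) : Grp C := ⟨Z n⟩
  -- The transition map lifts by `s n` and projects by `p m`. It is multiplicative because `p n ≫ s
  -- n ≫ p m = p m`, so the choice of lift is invisible after projecting.
  have hq (m n : ℕ) (hmn : m ≤ n) : IsMonHom (s n ≫ p m : (P n).X ⟶ (P m).X) := by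
    refine isMonHom_of_map_mul _ fun T x y ↦ ?_
    change (x * y) ≫ s n ≫ p m = (x ≫ s n ≫ p m) * (y ≫ s n ≫ p m)
    rw [(h n).mul_eq, Category.assoc, hps m n hmn, (h m).mul_comp, Category.assoc, Category.assoc]
  -- `ULift` places the index category in the universe prescribed by `IsProInfinitesimal`.
  let F : (ULift.{u} ℕ)ᵒᵖ ⥤ Grp C :=
    { obj j := P j.unop.down
      map {i j} f :=
        have := hq _ _ (ULift.down_le.2 f.unop.le)
        Grp.homMk (A := P i.unop.down) (B := P j.unop.down) (s i.unop.down ≫ p j.unop.down)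
      map_id i := Grp.hom_ext _ _ ((h _).s_p)
      map_comp {i j k} f g := Grp.hom_ext _ _ <| by
        change s _ ≫ p _ = (s _ ≫ p _) ≫ s _ ≫ p _
        rw [Category.assoc, hps _ _ (ULift.down_le.2 g.unop.le)] }
  let c : Cone F :=
    { pt := G
      π :=
      { app j := Grp.homMk (A := G) (B := P j.unop.down) (p j.unop.down)
        naturality {i j} f := Grp.hom_ext _ _ <| by
          change 𝟙 _ ≫ p _ = p _ ≫ s _ ≫ p _
          rw [Category.id_comp, hps _ _ (ULift.down_le.2 f.unop.le)] } }
  have hex (t : Cone F) : ∃ f : t.pt ⟶ G, ∀ j, f ≫ c.π.app j = t.π.app j := by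
    obtain ⟨f, hf⟩ := hlim t.pt.X (fun n ↦ (t.π.app (op ⟨n⟩)).hom.hom) fun m n hmn ↦
      congrArg (fun x ↦ x.hom.hom) (t.w (j := op ⟨n⟩) (j' := op ⟨m⟩)
        (homOfLE (show (⟨m⟩ : ULift.{u} ℕ) ≤ ⟨n⟩ from hmn)).op)
    -- The lift exists a priori only as a morphism of objects. It is multiplicative because its
    -- composites with all `p n` are, and these detect equality.
    have hf' : IsMonHom f := by
      refine isMonHom_of_map_mul _ fun T a b ↦ hext _ _ _ fun n ↦ ?_
      rw [(h n).mul_comp, Category.assoc, Category.assoc, Category.assoc, hf]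
      exact MonObj.mul_comp _ _ _
    exact ⟨Grp.homMk f, fun j ↦ Grp.hom_ext _ _ (hf j.unop.down)⟩
  choose f hf using hex
  exact ⟨F, c, fun j ↦ rfl, ⟨⟨f, hf, fun t g hg ↦ Grp.hom_ext _ _ <| hext _ _ _ fun n ↦
    congrArg (fun x ↦ x.hom.hom) ((hg (op ⟨n⟩)).trans (hf t (op ⟨n⟩)).symm)⟩⟩, ⟨Iso.refl _⟩⟩

end Retract
end RamifiedWitt

namespace RamifiedWitt
open MvPolynomial AlgebraicGeometry CategoryTheory Limits Opposite MonoidalCategory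
  CartesianMonoidalCategory MonObj

/-! ### Points of base changes and of the Witt scheme -/

section BaseChange

open scoped Obj

variable {S S' : Scheme.{u}} {b : S' ⟶ S}

lemma toBase_comp {Y : Over S} {T T' : Over S'} (g : T' ⟶ T) (f : T ⟶ (Over.pullback b).obj Y) :
    toBase (g ≫ f) = (Over.map b).map g ≫ toBase f := by
  ext1
  simp [toBase]

lemma toBase_comp_map {Y Y' : Over S} {T : Over S'} (f : T ⟶ (Over.pullback b).obj Y)
    (u : Y ⟶ Y') : toBase (f ≫ (Over.pullback b).map u) = toBase f ≫ u := by
  ext1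
  exact (Category.assoc _ _ _).trans ((congrArg (f.left ≫ ·) (pullback.lift_fst _ _ _)).trans
    (Category.assoc _ _ _).symm)

lemma toBase_bijective {Y : Over S} {T : Over S'} :
    Function.Bijective (toBase : (T ⟶ (Over.pullback b).obj Y) → _) := by
  refine ⟨fun f g h ↦ ?_, fun g ↦ ?_⟩
  · ext1
    refine pullback.hom_ext (congrArg (·.left) h) ?_
    exact (Over.w f).trans (Over.w g).symm
  · refine ⟨Over.homMk (pullback.lift g.left T.hom (Over.w g)) (pullback.lift_snd _ _ _), ?_⟩
    ext1
    exact pullback.lift_fst _ _ _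

lemma toBase_one {Y : Over S} [GrpObj Y] {T : Over S'} :
    toBase (1 : T ⟶ (Over.pullback b).obj Y) = 1 := by
  have h := toBase_mul (1 : T ⟶ (Over.pullback b).obj Y) 1
  rw [_root_.one_mul] at h
  exact left_eq_mul.1 h

end BaseChange

section WittScheme

variable {O : Type u} [CommRing O] [IsDomain O] [IsDiscreteValuationRing O]
  [Finite (IsLocalRing.ResidueField O)] {π : O} (hπ : Irreducible π)

lemma homEquiv_one (T : Over (Spec (.of O))) :
    homEquiv T (1 : T ⟶ (wittScheme hπ).X) = 0 := by
  have h := wittEquiv_mul hπ (1 : T ⟶ (wittScheme hπ).X) 1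
  rw [_root_.one_mul] at h
  exact (left_eq_add (M := WittVec hπ (sections T))).1 h

/-- Triangularity of Witt vector addition, carried over to points of the group scheme; this is what
makes truncations of subgroups into groups. -/
lemma homEquiv_mul_congr {T : Over (Spec (.of O))} {f f' g g' : T ⟶ (wittScheme hπ).X} {n : ℕ}
    (hf : ∀ i ≤ n, homEquiv T f i = homEquiv T f' i)
    (hg : ∀ i ≤ n, homEquiv T g i = homEquiv T g' i) :
    homEquiv T (f * g : T ⟶ (wittScheme hπ).X) n = homEquiv T (f' * g' : T ⟶ (wittScheme hπ).X) n :=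
  (congrFun (wittEquiv_mul hπ f g) n).trans
    ((aeval_addPoly_congr hπ hf hg).trans (congrFun (wittEquiv_mul hπ f' g') n).symm)

end WittScheme

/-! ### Recognizing infinite affine space by its coordinates -/

section Coordinates

variable {k : Type u} [CommRing k]

/-- A natural system of coordinates on the points of a scheme over `k` identifies it with
`Spec k[X₀, X₁, …]`. -/
def isoOfCoordinates (Y : Over (Spec (.of k)))
    (pts : ∀ T : Over (Spec (.of k)), (T ⟶ Y) ≃ (ℕ → sections T))
    (hpts : ∀ {S T : Over (Spec (.of k))} (g : S ⟶ T) (f : T ⟶ Y) (i : ℕ),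
      pts S (g ≫ f) i = ((algΓ (.of k)).map g).unop.hom (pts T f i)) : Y ≅ affineSpace k where
  hom := (homEquiv Y).symm (pts Y (𝟙 Y))
  inv := (pts (affineSpace k)).symm (homEquiv _ (𝟙 _))
  hom_inv_id := by
    apply (pts Y).injective
    funext i
    rw [hpts, Equiv.apply_symm_apply, ← homEquiv_comp, Category.comp_id, Equiv.apply_symm_apply]
  inv_hom_id := by
    apply (homEquiv _).injective
    funext i
    rw [homEquiv_comp, Equiv.apply_symm_apply, ← hpts, Category.comp_id, Equiv.apply_symm_apply]

lemma homEquiv_comp_isoOfCoordinates (Y : Over (Spec (.of k)))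
    (pts : ∀ T : Over (Spec (.of k)), (T ⟶ Y) ≃ (ℕ → sections T))
    (hpts : ∀ {S T : Over (Spec (.of k))} (g : S ⟶ T) (f : T ⟶ Y) (i : ℕ),
      pts S (g ≫ f) i = ((algΓ (.of k)).map g).unop.hom (pts T f i)) {T : Over (Spec (.of k))}
    (f : T ⟶ Y) : homEquiv T (f ≫ (isoOfCoordinates Y pts hpts).hom) = pts T f := by
  funext i
  rw [homEquiv_comp]
  change ((algΓ (.of k)).map f).unop.hom (homEquiv Y ((homEquiv Y).symm (pts Y (𝟙 Y))) i) = _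
  rw [Equiv.apply_symm_apply, ← hpts, Category.comp_id]

/-- The endomorphism of `Spec k[X₀, X₁, …]` given by an endomorphism of `k[X₀, X₁, …]`. -/
def affineSpaceMap (θ : MvPolynomial ℕ k →ₐ[k] MvPolynomial ℕ k) : affineSpace k ⟶ affineSpace k :=
  Over.homMk (Spec.map (CommRingCat.ofHom θ.toRingHom)) <| by
    simp only [affineSpace, Over.mk_hom, ← Spec.map_comp, ← CommRingCat.ofHom_comp]
    congr 2
    exact θ.comp_algebraMap

/-- Pulling back a function along a point is evaluation at its coordinates: the two ring
homomorphisms agree on constants and on variables. -/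
lemma appTop_ΓSpecIso_inv {T : Over (Spec (.of k))} (f : T ⟶ affineSpace k)
    (P : MvPolynomial ℕ k) :
    f.left.appTop ((Scheme.ΓSpecIso (.of (MvPolynomial ℕ k))).inv P) =
      aeval (S₁ := sections T) (homEquiv T f) P := by
  have h : ((Scheme.ΓSpecIso (.of (MvPolynomial ℕ k))).inv ≫ f.left.appTop).hom =
      (aeval (homEquiv T f) : MvPolynomial ℕ k →ₐ[k] sections T).toRingHom := by
    refine MvPolynomial.ringHom_ext (fun x ↦ ?_) fun i ↦ ?_
    · refine Eq.trans ?_ (aeval_C (S₁ := sections T) _ x).symm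
      exact (ConcreteCategory.congr_hom (ΓSpecIso_inv_comp_appTop (CommRingCat.ofHom C) f.left T.hom
        (Over.w f)) x).symm
    · exact (aeval_X (R := k) (S₁ := sections T) (homEquiv T f) i).symm
  exact RingHom.congr_fun h P

lemma homEquiv_comp_affineSpaceMap {T : Over (Spec (.of k))} (f : T ⟶ affineSpace k)
    (θ : MvPolynomial ℕ k →ₐ[k] MvPolynomial ℕ k) (n : ℕ) :
    homEquiv T (f ≫ affineSpaceMap θ) n = aeval (homEquiv T f) (θ (X n)) := by
  refine Eq.trans ?_ (appTop_ΓSpecIso_inv f (θ (X n)))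
  refine congrArg f.left.appTop ?_
  exact (ConcreteCategory.congr_hom
    (Scheme.ΓSpecIso_inv_naturality (CommRingCat.ofHom θ.toRingHom)) (X n)).symm

end Coordinates
end RamifiedWitt

namespace RamifiedWitt
open MvPolynomial AlgebraicGeometry CategoryTheory Limits Opposite MonoidalCategory
  CartesianMonoidalCategory MonObj

/-! ### The subscheme where given powers of the coordinates vanish -/

section Truncated

variable (k : Type u) [CommRing k] (e : ℕ → ℕ)

/-- The ideal generated by given powers of the variables. -/
abbrev powIdeal : Ideal (MvPolynomial ℕ k) := Ideal.span (Set.range fun i : ℕ ↦ X i ^ e i)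

/-- The closed subscheme of `Spec k[X₀, X₁, …]` where given powers of the coordinates vanish. -/
abbrev powScheme : Over (Spec (.of k)) :=
  Over.mk (Spec.map (CommRingCat.ofHom (algebraMap k (MvPolynomial ℕ k ⧸ powIdeal k e))))

/-- The inclusion of `powScheme` in `Spec k[X₀, X₁, …]`. -/
def powInclusion : powScheme k e ⟶ affineSpace k :=
  Over.homMk (Spec.map (CommRingCat.ofHom (Ideal.Quotient.mk (powIdeal k e)))) <| by
    simp only [affineSpace, Over.mk_hom, ← Spec.map_comp, ← CommRingCat.ofHom_comp]
    rfl

variable {k e}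

instance : Mono (powInclusion k e) := by
  have : IsClosedImmersion (powInclusion k e).left :=
    IsClosedImmersion.spec_of_surjective _ Ideal.Quotient.mk_surjective
  have : Mono (powInclusion k e).left := inferInstance
  exact Over.mono_of_mono_left _

lemma homEquiv_powInclusion_pow {T : Over (Spec (.of k))} (f : T ⟶ powScheme k e) (i : ℕ) :
    homEquiv T (f ≫ powInclusion k e) i ^ e i = 0 := by
  have h : homEquiv _ (powInclusion k e) i ^ e i = 0 := by
    have h1 : aeval (homEquiv _ (powInclusion k e)) (X i ^ e i : MvPolynomial ℕ k) =
        homEquiv _ (powInclusion k e) i ^ e i := by rw [map_pow, aeval_X]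
    refine h1.symm.trans ((appTop_ΓSpecIso_inv (powInclusion k e) (X i ^ e i)).symm.trans ?_)
    refine (ConcreteCategory.congr_hom (Scheme.ΓSpecIso_inv_naturality
      (CommRingCat.ofHom (Ideal.Quotient.mk (powIdeal k e)))) (X i ^ e i)).symm.trans ?_
    have h2 : Ideal.Quotient.mk (powIdeal k e) (X i ^ e i) = 0 :=
      Ideal.Quotient.eq_zero_iff_mem.2 (Ideal.subset_span ⟨i, rfl⟩)
    exact (congrArg (Scheme.ΓSpecIso _).inv h2).trans (map_zero _)
  rw [homEquiv_comp, ← map_pow, h, map_zero]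

/-- Evaluation at the coordinates kills the generators of `powIdeal`, hence factors through the
quotient. With `homEquiv_powInclusion_pow`, this describes the points of `powScheme`. -/
lemma exists_comp_powInclusion {T : Over (Spec (.of k))} (g : T ⟶ affineSpace k)
    (hg : ∀ i, homEquiv T g i ^ e i = 0) : ∃ f, f ≫ powInclusion k e = g := by
  obtain ⟨v, rfl⟩ := (homEquiv T).symm.surjective g
  simp only [Equiv.apply_symm_apply] at hg
  have hle : ∀ P ∈ powIdeal k e, aeval (S₁ := sections T) v P = 0 := by
    refine fun P hP ↦ RingHom.mem_ker.1
      (Ideal.span_le (I := RingHom.ker (aeval (R := k) (S₁ := sections T) v)).2 ?_ hP)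
    rintro _ ⟨i, rfl⟩
    exact RingHom.mem_ker.2 (by rw [map_pow, aeval_X]; exact hg i)
  let l := Ideal.Quotient.liftₐ (powIdeal k e) (aeval (R := k) (S₁ := sections T) v) hle
  refine ⟨Over.homMk (T.left.toSpecΓ ≫ Spec.map (CommRingCat.ofHom l.toRingHom)) ?_, ?_⟩
  · refine Eq.trans ?_ (eq_toSpecΓ_comp T.hom).symm
    simp only [Over.mk_hom, Category.assoc, ← Spec.map_comp]
    congr 2
    ext x
    exact l.commutes x
  · ext1
    refine (Category.assoc _ _ _).trans (congrArg (T.left.toSpecΓ ≫ ·) ?_)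
    refine (Spec.map_comp _ _).symm.trans (congrArg Spec.map ?_)
    rfl

end Truncated

/-- An exponent `1` makes the variable vanish, so the algebra is generated by the first `N`
variables. These are nilpotent, hence integral. -/
lemma isFinite_powScheme {k : Type u} [Field k] {e : ℕ → ℕ} {N : ℕ} (he : ∀ i, e i ≠ 0)
    (hN : ∀ i, N ≤ i → e i = 1) : IsFinite (powScheme k e).hom := by
  refine (IsFinite.SpecMap_iff _).2 ?_
  have h0 (i : ℕ) : (Ideal.Quotient.mk (powIdeal k e) (X i)) ^ e i = 0 := by
    rw [← map_pow]
    exact Ideal.Quotient.eq_zero_iff_mem.2 (Ideal.subset_span ⟨i, rfl⟩)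
  let S : Set (MvPolynomial ℕ k ⧸ powIdeal k e) :=
    (fun i ↦ Ideal.Quotient.mk (powIdeal k e) (X i)) '' Set.Iio N
  have hS : Algebra.adjoin k S = ⊤ := by
    rw [eq_top_iff, ← AlgHom.range_eq_top (Ideal.Quotient.mkₐ k (powIdeal k e)) |>.2
      (Ideal.Quotient.mkₐ_surjective _ _), ← Algebra.map_top, ← MvPolynomial.adjoin_range_X,
      AlgHom.map_adjoin, Algebra.adjoin_le_iff]
    rintro _ ⟨_, ⟨i, rfl⟩, rfl⟩
    by_cases hi : i < N
    · exact Algebra.subset_adjoin ⟨i, hi, rfl⟩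
    · have := h0 i
      rw [hN i (not_lt.1 hi), pow_one] at this
      change Ideal.Quotient.mk (powIdeal k e) (X i) ∈ _
      rw [this]
      exact zero_mem _
  have : Module.Finite k (MvPolynomial ℕ k ⧸ powIdeal k e) := by
    have h1 := fg_adjoin_of_finite (R := k) (s := S) ((Set.finite_Iio N).image _) <| by
      rintro _ ⟨i, _, rfl⟩
      exact IsIntegral.of_pow (Nat.pos_of_ne_zero (he i)) (by rw [h0]; exact isIntegral_zero)
    rw [hS] at h1
    exact ⟨by simpa using h1⟩
  exact RingHom.finite_algebraMap.2 this

/-- A prime contains every variable, since a power of it is zero. Its preimage therefore contains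
the kernel of evaluation at the origin, which is maximal. -/
lemma subsingleton_powScheme {k : Type u} [Field k] {e : ℕ → ℕ} :
    Subsingleton (powScheme k e).left := by
  let A := MvPolynomial ℕ k ⧸ powIdeal k e
  have h0 (i : ℕ) : (Ideal.Quotient.mk (powIdeal k e) (X i)) ^ e i = 0 := by
    rw [← map_pow]
    exact Ideal.Quotient.eq_zero_iff_mem.2 (Ideal.subset_span ⟨i, rfl⟩)
  have key (P : PrimeSpectrum A) : P.asIdeal.comap (Ideal.Quotient.mk (powIdeal k e)) =
      RingHom.ker (aeval (R := k) (0 : ℕ → k)) := by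
    have hX (i) : (X i : MvPolynomial ℕ k) ∈ P.asIdeal.comap (Ideal.Quotient.mk (powIdeal k e)) :=
      P.2.mem_of_pow_mem (e i) (by rw [h0]; exact zero_mem _)
    have hle : RingHom.ker (aeval (R := k) (0 : ℕ → k)) ≤
        P.asIdeal.comap (Ideal.Quotient.mk (powIdeal k e)) := fun f hf ↦ by
      have h1 : f - C (aeval (0 : ℕ → k) f) ∈
          P.asIdeal.comap (Ideal.Quotient.mk (powIdeal k e)) := by
        clear hf
        induction f using MvPolynomial.induction_on with
        | C a => simp
        | add f g hf hg =>
          rw [map_add, map_add, add_sub_add_comm]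
          exact add_mem hf hg
        | mul_X f i _ =>
          simp only [map_mul, aeval_X, Pi.zero_apply, mul_zero, map_zero, sub_zero]
          exact Ideal.mul_mem_left _ _ (hX i)
      rwa [RingHom.mem_ker.1 hf, map_zero, sub_zero] at h1
    have hmax : (RingHom.ker (aeval (R := k) (0 : ℕ → k))).IsMaximal :=
      RingHom.ker_isMaximal_of_surjective (aeval (R := k) (0 : ℕ → k)).toRingHom
        fun a ↦ ⟨C a, by simp⟩
    exact (hmax.eq_of_le (Ideal.comap_ne_top _ P.2.ne_top) hle).symm
  exact ⟨fun P Q ↦ PrimeSpectrum.ext (Ideal.comap_injective_of_surjective _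
    Ideal.Quotient.mk_surjective ((key P).trans (key Q).symm))⟩

end RamifiedWitt

namespace RamifiedWitt
open MvPolynomial AlgebraicGeometry CategoryTheory Limits Opposite MonoidalCategory
  CartesianMonoidalCategory MonObj

/-! ### Drinfeld's morphism on special fibers, in coordinates -/

section SpecialFiber

variable {O : Type u} [CommRing O] [IsDomain O] [IsDiscreteValuationRing O]
  [Finite (IsLocalRing.ResidueField O)] {O' : Type u} [CommRing O'] [IsDomain O']
  [IsDiscreteValuationRing O'] [Finite (IsLocalRing.ResidueField O')] [Algebra O O']
  [Module.Finite O O'] [FaithfulSMul O O'] {π : O} {ϖ : O'}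

variable (O') in
/-- The special fiber of the scheme of ramified Witt vectors over `O'`. -/
abbrev wittFiber (hϖ : Irreducible ϖ) :=
  (Over.pullback (baseMap O' (IsLocalRing.ResidueField O'))).mapGrp.obj (wittScheme hϖ)

variable (O') in
/-- The base change of the scheme of ramified Witt vectors over `O` to the residue field of `O'`. -/
abbrev wittFiberBase (hπ : Irreducible π) :=
  (Over.pullback (baseMap O' (IsLocalRing.ResidueField O'))).mapGrp.obj
        ((Over.pullback (baseMap O O')).mapGrp.obj (wittScheme hπ))

variable {T T' : Over (Spec (.of (IsLocalRing.ResidueField O')))}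

/-- The coordinates of a point of the special fiber of the scheme of ramified Witt vectors. -/
def fiberPts (hϖ : Irreducible ϖ) (T : Over (Spec (.of (IsLocalRing.ResidueField O')))) :
    (T ⟶ (wittFiber O' hϖ).X) ≃ (ℕ → sections T) :=
  (Equiv.ofBijective _ toBase_bijective).trans
    (homEquiv ((Over.map (baseMap O' (IsLocalRing.ResidueField O'))).obj T))

/-- The coordinates of a point of the base change to the residue field of `O'` of the scheme of
ramified Witt vectors over `O`. -/
def fiberBasePts (hπ : Irreducible π) (T : Over (Spec (.of (IsLocalRing.ResidueField O')))) :
    (T ⟶ (wittFiberBase O' hπ).X) ≃ (ℕ → sections T) :=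
  (Equiv.ofBijective _ toBase_bijective).trans <|
    (Equiv.ofBijective _ toBase_bijective).trans <|
    homEquiv ((Over.map (baseMap O O')).obj
      ((Over.map (baseMap O' (IsLocalRing.ResidueField O'))).obj T))

lemma fiberPts_comp (hϖ : Irreducible ϖ) (g : T' ⟶ T) (f : T ⟶ (wittFiber O' hϖ).X) (i : ℕ) :
    fiberPts hϖ T' (g ≫ f) i =
      ((algΓ (.of (IsLocalRing.ResidueField O'))).map g).unop.hom (fiberPts hϖ T f i) :=
  (congrArg (fun x ↦ homEquiv _ x i) (toBase_comp g f)).trans (homEquiv_comp _ _ i)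

lemma fiberBasePts_comp (hπ : Irreducible π) (g : T' ⟶ T) (f : T ⟶ (wittFiberBase O' hπ).X)
    (i : ℕ) : fiberBasePts hπ T' (g ≫ f) i =
      ((algΓ (.of (IsLocalRing.ResidueField O'))).map g).unop.hom (fiberBasePts hπ T f i) :=
  (congrArg (fun x ↦ homEquiv _ x i) ((congrArg toBase (toBase_comp g f)).trans
    (toBase_comp _ _))).trans (homEquiv_comp _ _ i)

lemma fiberPts_one (hϖ : Irreducible ϖ) :
    fiberPts hϖ T (1 : T ⟶ (wittFiber O' hϖ).X) = 0 := by
  have h : toBase (1 : T ⟶ (wittFiber O' hϖ).X) =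
      (1 : (Over.map (baseMap O' (IsLocalRing.ResidueField O'))).obj T ⟶ (wittScheme hϖ).X) :=
    toBase_one
  exact (congrArg (homEquiv _) h).trans (homEquiv_one hϖ _)

lemma fiberBasePts_mul_congr (hπ : Irreducible π) {f f' g g' : T ⟶ (wittFiberBase O' hπ).X} {n : ℕ}
    (hf : ∀ i ≤ n, fiberBasePts hπ T f i = fiberBasePts hπ T f' i)
    (hg : ∀ i ≤ n, fiberBasePts hπ T g i = fiberBasePts hπ T g' i) :
    fiberBasePts hπ T (f * g) n = fiberBasePts hπ T (f' * g') n := by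
  have h (f g : T ⟶ (wittFiberBase O' hπ).X) : fiberBasePts hπ T (f * g) =
      homEquiv _ (toBase (toBase f) * toBase (toBase g) : _ ⟶ (wittScheme hπ).X) :=
    congrArg (homEquiv _) ((congrArg toBase (toBase_mul f g)).trans (toBase_mul _ _))
  rw [h, h]
  exact homEquiv_mul_congr hπ hf hg

/-- Links the scheme to the polynomials: a point of the special fiber is a point over `Spec O'`,
where `drinfeldHom` evaluates `drinfeldPoly` at the coordinates. -/
lemma fiberPts_comp_drinfeldSpecialFiber (hπ : Irreducible π) (hϖ : Irreducible ϖ) {r : ℕ}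
    (hr : resCard O' = resCard O ^ r) (f : T ⟶ (wittFiberBase O' hπ).X) (n : ℕ) :
    fiberPts hϖ T (f ≫ (drinfeldSpecialFiber hπ hϖ hr).hom.hom) n =
      aeval (fiberBasePts hπ T f) (reduction O' (drinfeldPoly π ϖ r) (X n)) := by
  -- The `O'`-algebra structure is that of `T` regarded as a scheme over `Spec O'`; the tower
  -- instance says that it factors through the residue field.
  let : Algebra O' (sections T) := inferInstanceAs (Algebra O'
    (sections ((Over.map (baseMap O' (IsLocalRing.ResidueField O'))).obj T)))
  have : IsScalarTower O' (IsLocalRing.ResidueField O') (sections T) :=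
    IsScalarTower.of_algebraMap_eq fun x ↦ ConcreteCategory.congr_hom (ΓSpecIso_inv_comp_appTop
      (CommRingCat.ofHom (algebraMap O' (IsLocalRing.ResidueField O'))) T.hom
      ((Over.map (baseMap O' (IsLocalRing.ResidueField O'))).obj T).hom rfl) x
  rw [aeval_reduction_X]
  refine (congrArg (fun x ↦ homEquiv _ x n)
    (toBase_comp_map f (drinfeldHom O O' π ϖ r))).trans ?_
  exact congrFun (homEquiv_comp_drinfeldHom r (toBase f)) n

/-- Drinfeld's morphism on special fibers is a morphism between infinite-dimensional affine
spaces. -/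
def drinfeldSpecialFiberIso (hπ : Irreducible π) (hϖ : Irreducible ϖ) {r : ℕ}
    (hr : resCard O' = resCard O ^ r) :
    Arrow.mk (affineSpaceMap (reduction O' (drinfeldPoly π ϖ r))) ≅
      Arrow.mk (drinfeldSpecialFiber hπ hϖ hr).hom.hom :=
  (Arrow.isoMk (isoOfCoordinates _ (fiberBasePts hπ) (fiberBasePts_comp hπ))
    (isoOfCoordinates _ (fiberPts hϖ) (fiberPts_comp hϖ)) <| by
      apply (homEquiv _).injective
      funext n
      refine (homEquiv_comp_affineSpaceMap _ _ n).trans (Eq.trans ?_ (congrFun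
        (homEquiv_comp_isoOfCoordinates _ (fiberPts hϖ) (fiberPts_comp hϖ) _) n).symm)
      have h := fiberPts_comp_drinfeldSpecialFiber hπ hϖ hr (𝟙 _) n
      rw [Category.id_comp] at h
      refine Eq.trans ?_ h.symm
      congr 2
      exact Equiv.apply_symm_apply _ _).symm

variable [Algebra.Unramified O O']

lemma isUniversalHomeomorphism_drinfeldSpecialFiber (hπ : Irreducible π) (hϖ : Irreducible ϖ)
    {r : ℕ} (hr : resCard O' = resCard O ^ r) :
    IsUniversalHomeomorphism (drinfeldSpecialFiber hπ hϖ hr).hom.hom.left := by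
  refine IsUniversalHomeomorphism.of_arrow_iso
    ((Over.forget _).mapArrow.mapIso (drinfeldSpecialFiberIso hπ hϖ hr)) ?_
  obtain ⟨p, h, hp, hq, hpp⟩ := exists_resCard_eq hπ
  have hπ' := irreducible_algebraMap (O' := O') hπ
  -- `π` divides `p` in `O` and remains a uniformizer of `O'`, so `p` vanishes in the residue field
  -- of `O'`.
  have hp0 : (p : IsLocalRing.ResidueField O') = 0 := by
    have h1 := map_dvd (algebraMap O O') hpp
    rw [map_natCast, dvd_iff_residue hπ', map_natCast] at h1
    exact h1
  have : CharP (IsLocalRing.ResidueField O') p := (CharP.charP_iff_prime_eq_zero hp).2 hp0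
  have : ExpChar (IsLocalRing.ResidueField O') p := ExpChar.prime hp
  refine isUniversalHomeomorphism_SpecMap p (reduction O' (drinfeldPoly π ϖ r))
    (reduction_drinfeldPoly_injective hπ hϖ hr)
    (exists_pow_mem_range_reduction_drinfeldPoly hπ hϖ hr p hq)

/-- A point of the special fiber lies in the kernel of Drinfeld's morphism if and only if given
powers of its coordinates vanish. -/
lemma comp_drinfeldSpecialFiber_eq_one_iff (hπ : Irreducible π) (hϖ : Irreducible ϖ) {r : ℕ}
    (hr : resCard O' = resCard O ^ r) (f : T ⟶ (wittFiberBase O' hπ).X) :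
    f ≫ (drinfeldSpecialFiber hπ hϖ hr).hom.hom = 1 ↔
      ∀ n, fiberBasePts hπ T f n ^ resCard O ^ (n * (r - 1)) = 0 := by
  let : Algebra O' (sections T) := Algebra.compHom _ (algebraMap O' (IsLocalRing.ResidueField O'))
  have : IsScalarTower O' (IsLocalRing.ResidueField O') (sections T) :=
    IsScalarTower.of_algebraMap_eq fun x ↦ rfl
  rw [← aeval_drinfeldPoly_eq_zero_iff hπ hϖ hr (by
    rw [IsScalarTower.algebraMap_apply O' (IsLocalRing.ResidueField O'),
      algebraMap_residue_eq_zero hϖ, map_zero]), ← (fiberPts hϖ T).injective.eq_iff,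
    fiberPts_one, funext_iff]
  simp only [fiberPts_comp_drinfeldSpecialFiber, aeval_reduction_X]
  rfl

end SpecialFiber
end RamifiedWitt

namespace RamifiedWitt
open MvPolynomial AlgebraicGeometry CategoryTheory Limits Opposite MonoidalCategory
  CartesianMonoidalCategory MonObj

/-! ### Kernels of group schemes and pro-infinitesimality -/

section Kernel

variable {C : Type*} [Category.{v} C] [CartesianMonoidalCategory C]
  [HasLimitsOfShape WalkingParallelPair C] {G G' : Grp C} (u : G ⟶ G')

/-- The kernel of a homomorphism of group objects is an equalizer of the underlying objects. -/
def isLimitForkKernel : IsLimit (Fork.ofι (f := u.hom.hom) (g := (0 : G ⟶ G').hom.hom)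
    (kernel.ι u).hom.hom (congrArg (fun x ↦ x.hom.hom)
      ((kernel.condition u).trans comp_zero.symm))) :=
  isLimitForkMapOfIsLimit (Grp.forget C) _ (kernelIsKernel u)

instance : Mono (kernel.ι u).hom.hom :=
  ⟨fun _ _ h ↦ Fork.IsLimit.hom_ext (isLimitForkKernel u) h⟩

lemma comp_kernel_ι_comp {T : C} (f : T ⟶ (kernel u).X) :
    (f ≫ (kernel.ι u).hom.hom) ≫ u.hom.hom = 1 := by
  have h : (kernel.ι u).hom.hom ≫ u.hom.hom = 1 :=
    congrArg (fun x ↦ x.hom.hom) (kernel.condition u)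
  rw [Category.assoc, h, MonObj.comp_one]

/-- With `comp_kernel_ι_comp`, identifies the points of the kernel object with the points that `u`
sends to the identity. -/
lemma exists_comp_kernel_ι {T : C} (g : T ⟶ G.X) (hg : g ≫ u.hom.hom = 1) :
    ∃ f : T ⟶ (kernel u).X, f ≫ (kernel.ι u).hom.hom = g := by
  have h : g ≫ (0 : G ⟶ G').hom.hom = 1 := MonObj.comp_one (M := G'.X) g
  exact ⟨Fork.IsLimit.lift (isLimitForkKernel u) g (hg.trans h.symm),
    Fork.IsLimit.lift_ι (isLimitForkKernel u)⟩

end Kernel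

/-- Two subobjects that contain each other are isomorphic. -/
def isoOfMono {C : Type*} [Category.{v} C] {A B X : C} (i : A ⟶ X) (j : B ⟶ X) [Mono i] [Mono j]
    (f : A ⟶ B) (g : B ⟶ A) (hf : f ≫ j = i) (hg : g ≫ i = j) : A ≅ B where
  hom := f
  inv := g
  hom_inv_id := by rw [← cancel_mono i, Category.assoc, hg, hf, Category.id_comp]
  inv_hom_id := by rw [← cancel_mono j, Category.assoc, hf, hg, Category.id_comp]

/-- A group scheme over `k` whose points are the sequences of sections with prescribed powers equal
to zero, with triangular multiplication, is pro-infinitesimal. -/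
lemma isProInfinitesimal_of_iso_powScheme {k : Type u} [Field k] {e : ℕ → ℕ} (he : ∀ i, e i ≠ 0)
    (G : Grp (Over (Spec (.of k)))) (α : G.X ≅ powScheme k e)
    (hmul : ∀ (T : Over (Spec (.of k))) (f f' g g' : T ⟶ G.X) (n : ℕ),
      (∀ i ≤ n, homEquiv T (f ≫ α.hom ≫ powInclusion k e) i =
        homEquiv T (f' ≫ α.hom ≫ powInclusion k e) i) →
      (∀ i ≤ n, homEquiv T (g ≫ α.hom ≫ powInclusion k e) i =
        homEquiv T (g' ≫ α.hom ≫ powInclusion k e) i) →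
      homEquiv T ((f * g) ≫ α.hom ≫ powInclusion k e) n =
        homEquiv T ((f' * g') ≫ α.hom ≫ powInclusion k e) n) :
    IsProInfinitesimal G := by
  set κ := α.hom ≫ powInclusion k e with hκ
  have : Mono κ := mono_comp _ _
  -- The exponent `1` from index `N` on forces those coordinates to vanish, so `powScheme k (e' N)`
  -- retains only the first `N`.
  let e' (N i : ℕ) : ℕ := if i < N then e i else 1
  have he' (N i) : e' N i ≠ 0 := by
    dsimp only [e']; split_ifs; exacts [he i, one_ne_zero]
  have hlift {T : Over (Spec (.of k))} (g : T ⟶ affineSpace k)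
      (hg : ∀ i, homEquiv T g i ^ e i = 0) : ∃ f : T ⟶ G.X, f ≫ κ = g := by
    obtain ⟨f, rfl⟩ := exists_comp_powInclusion g hg
    exact ⟨f ≫ α.inv, by simp [hκ]⟩
  have hp (N : ℕ) : ∃ p : G.X ⟶ powScheme k (e' N), ∀ i, homEquiv _ (p ≫ powInclusion k (e' N)) i =
      if i < N then homEquiv _ κ i else 0 := by
    obtain ⟨p, hp⟩ := exists_comp_powInclusion (e := e' N)
      ((homEquiv G.X).symm fun i ↦ if i < N then homEquiv _ κ i else 0) fun i ↦ by
        rw [Equiv.apply_symm_apply]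
        dsimp only [e']
        split_ifs
        · exact homEquiv_powInclusion_pow α.hom i
        · exact pow_one _
    exact ⟨p, fun i ↦ by rw [hp, Equiv.apply_symm_apply]⟩
  -- The section extends a truncated sequence by zeros. It lands in `G` because `1 ≤ e i`.
  have hs (N : ℕ) : ∃ s : powScheme k (e' N) ⟶ G.X, s ≫ κ = powInclusion k (e' N) := by
    refine hlift _ fun i ↦ ?_
    have h := homEquiv_powInclusion_pow (𝟙 (powScheme k (e' N))) i
    rw [Category.id_comp] at h
    refine pow_eq_zero_of_le ?_ h
    dsimp only [e']
    split_ifs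
    exacts [le_rfl, Nat.one_le_iff_ne_zero.2 (he i)]
  choose p hp using hp
  choose s hs using hs
  have hpp {T : Over (Spec (.of k))} (N : ℕ) (f : T ⟶ G.X) (i : ℕ) :
      homEquiv T ((f ≫ p N) ≫ powInclusion k (e' N)) i =
        if i < N then homEquiv T (f ≫ κ) i else 0 := by
    rw [Category.assoc, homEquiv_comp, hp]
    split_ifs
    exacts [(homEquiv_comp f κ i).symm, map_zero _]
  have hvan {T : Over (Spec (.of k))} (N : ℕ) (x : T ⟶ powScheme k (e' N)) {i : ℕ} (hi : ¬ i < N) :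
      homEquiv T (x ≫ powInclusion k (e' N)) i = 0 := by
    have h := homEquiv_powInclusion_pow x i
    rwa [show e' N i = 1 from if_neg hi, pow_one] at h
  have hZext {T : Over (Spec (.of k))} (N : ℕ) {x y : T ⟶ powScheme k (e' N)}
      (h : ∀ i < N, homEquiv T (x ≫ powInclusion k (e' N)) i =
        homEquiv T (y ≫ powInclusion k (e' N)) i) : x = y := by
    rw [← cancel_mono (powInclusion k (e' N))]
    apply (homEquiv T).injective
    funext i
    by_cases hi : i < N
    · exact h i hi
    · rw [hvan N x hi, hvan N y hi]
  have hpeq {T : Over (Spec (.of k))} (N : ℕ) (f g : T ⟶ G.X) : f ≫ p N = g ≫ p N ↔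
      ∀ i < N, homEquiv T (f ≫ κ) i = homEquiv T (g ≫ κ) i := by
    refine ⟨fun h i hi ↦ ?_, fun h ↦ hZext N fun i hi ↦ ?_⟩
    · have := hpp N f i
      rwa [h, hpp, if_pos hi, if_pos hi, eq_comm] at this
    · rw [hpp, hpp, if_pos hi, if_pos hi, h i hi]
  have hsp {T : Over (Spec (.of k))} (M N : ℕ) (hMN : M ≤ N) (x : T ⟶ powScheme k (e' N)) (i : ℕ)
      (hi : i < M) : homEquiv T ((x ≫ s N ≫ p M) ≫ powInclusion k (e' M)) i =
        homEquiv T (x ≫ powInclusion k (e' N)) i := by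
    rw [← Category.assoc x, hpp, if_pos hi, Category.assoc, hs]
  -- By triangularity, coordinate `i < N` of a product depends only on coordinates of index at most
  -- `i`, all seen by `p N`.
  have hret (N) : IsGroupRetract (p N) (s N) := by
    refine ⟨hZext N fun i hi ↦ ?_, fun T a a' b b' ha hb ↦ ?_⟩
    · have := hsp N N le_rfl (𝟙 _) i hi
      simpa only [Category.id_comp] using this
    · rw [hpeq] at ha hb ⊢
      exact fun i hi ↦ hmul T a a' b b' i (fun j hj ↦ ha j (hj.trans_lt hi))
        fun j hj ↦ hb j (hj.trans_lt hi)
  obtain ⟨F, c, hF, hc, hcG⟩ := exists_limit_of_isGroupRetract.{u} G (fun N ↦ powScheme k (e' N)) p s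
    hret (fun M N hMN ↦ hZext M fun i hi ↦ by
      rw [hsp M N hMN _ i hi, hp, hp, if_pos hi, if_pos (hi.trans_le hMN)])
    (fun T x hx ↦ by
      -- The `i`-th coordinate of the limit point is read off at level `i + 1`, the first truncation
      -- that retains index `i`; compatibility makes higher levels agree.
      obtain ⟨f, hf⟩ := hlift ((homEquiv T).symm fun i ↦
          homEquiv T (x (i + 1) ≫ powInclusion k (e' (i + 1))) i) fun i ↦ by
        rw [Equiv.apply_symm_apply]
        have h := homEquiv_powInclusion_pow (x (i + 1)) i
        rwa [show e' (i + 1) i = e i from if_pos i.lt_succ_self] at h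
      refine ⟨f, fun N ↦ hZext N fun i hi ↦ ?_⟩
      rw [hpp, if_pos hi, hf, Equiv.apply_symm_apply]
      have h := hsp (i + 1) N hi (x N) i i.lt_succ_self
      rwa [hx (i + 1) N hi] at h)
    (fun T f g h ↦ by
      rw [← cancel_mono κ]
      apply (homEquiv T).injective
      funext i
      exact (hpeq (i + 1) f g).1 (h (i + 1)) i i.lt_succ_self)
  refine ⟨_, _, inferInstance, F, c, fun j ↦ ?_, hc, hcG⟩
  rw [IsInfinitesimal, hF]
  exact ⟨isFinite_powScheme (he' _) (N := j.unop.down) fun i hi ↦ if_neg (not_lt.2 hi),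
    subsingleton_powScheme⟩

end RamifiedWitt

namespace RamifiedWitt
open MvPolynomial AlgebraicGeometry CategoryTheory Limits Opposite MonoidalCategory
  CartesianMonoidalCategory MonObj

/-! ### The kernel of Drinfeld's morphism on special fibers -/

section DrinfeldKernel

variable {O : Type u} [CommRing O] [IsDomain O] [IsDiscreteValuationRing O]
  [Finite (IsLocalRing.ResidueField O)] {O' : Type u} [CommRing O'] [IsDomain O']
  [IsDiscreteValuationRing O'] [Finite (IsLocalRing.ResidueField O')] [Algebra O O']
  [Module.Finite O O'] [FaithfulSMul O O'] [Algebra.Unramified O O'] {π : O} {ϖ : O'}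

/-- The kernel of Drinfeld's morphism on special fibers. -/
lemma exists_iso_kernel_drinfeldSpecialFiber (hπ : Irreducible π) (hϖ : Irreducible ϖ) {r : ℕ}
    (hr : resCard O' = resCard O ^ r) :
    ∃ α : (kernel (drinfeldSpecialFiber hπ hϖ hr)).X ≅
        powScheme (IsLocalRing.ResidueField O') fun i ↦ resCard O ^ (i * (r - 1)),
      ∀ (T : Over (Spec (.of (IsLocalRing.ResidueField O')))) (f : T ⟶ _),
        homEquiv T (f ≫ α.hom ≫ powInclusion _ _) =
          fiberBasePts hπ T (f ≫ (kernel.ι (drinfeldSpecialFiber hπ hϖ hr)).hom.hom) := by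
  let e : ℕ → ℕ := fun i ↦ resCard O ^ (i * (r - 1))
  let β := isoOfCoordinates _ (fiberBasePts (O' := O') hπ) (fiberBasePts_comp hπ)
  have hβ {T : Over (Spec (.of (IsLocalRing.ResidueField O')))}
      (f : T ⟶ (wittFiberBase O' hπ).X) : homEquiv T (f ≫ β.hom) = fiberBasePts hπ T f :=
    homEquiv_comp_isoOfCoordinates _ (fiberBasePts (O' := O') hπ) (fiberBasePts_comp hπ) f
  let incl := (kernel.ι (drinfeldSpecialFiber hπ hϖ hr)).hom.hom
  have hincl (i : ℕ) : homEquiv _ (incl ≫ β.hom) i ^ e i = 0 := by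
    rw [hβ]
    refine (comp_drinfeldSpecialFiber_eq_one_iff hπ hϖ hr incl).1 ?_ i
    have h := comp_kernel_ι_comp (drinfeldSpecialFiber hπ hϖ hr) (𝟙 _)
    rwa [Category.id_comp] at h
  obtain ⟨f, hf⟩ := exists_comp_powInclusion _ hincl
  -- Conversely, `powScheme` maps into the kernel. The two subobjects of affine space contain each
  -- other and are therefore isomorphic.
  have hj : (powInclusion (IsLocalRing.ResidueField O') e ≫ β.inv) ≫
      (drinfeldSpecialFiber hπ hϖ hr).hom.hom = 1 := by
    refine (comp_drinfeldSpecialFiber_eq_one_iff hπ hϖ hr _).2 fun n ↦ ?_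
    rw [← hβ, Category.assoc, Iso.inv_hom_id, Category.comp_id]
    have h := homEquiv_powInclusion_pow (𝟙 (powScheme (IsLocalRing.ResidueField O') e)) n
    rwa [Category.id_comp] at h
  obtain ⟨g, hg⟩ := exists_comp_kernel_ι _ _ hj
  have : Mono incl := inferInstance
  have : Mono (incl ≫ β.hom) := mono_comp _ _
  refine ⟨isoOfMono (incl ≫ β.hom) (powInclusion _ e) f g hf ?_, fun T x ↦ ?_⟩
  · rw [← Category.assoc, hg, Category.assoc, Iso.inv_hom_id, Category.comp_id]
  · exact (congrArg (fun y ↦ homEquiv T (x ≫ y)) hf).trans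
      ((congrArg (homEquiv T) (Category.assoc x incl β.hom).symm).trans (hβ _))

/-- The inclusion of the kernel is a homomorphism, so the triangularity of addition passes from the
ambient Witt vectors to the kernel. -/
lemma isProInfinitesimal_kernel_drinfeldSpecialFiber (hπ : Irreducible π) (hϖ : Irreducible ϖ)
    {r : ℕ} (hr : resCard O' = resCard O ^ r) :
    IsProInfinitesimal (kernel (drinfeldSpecialFiber hπ hϖ hr)) := by
  obtain ⟨α, hα⟩ := exists_iso_kernel_drinfeldSpecialFiber hπ hϖ hr
  refine isProInfinitesimal_of_iso_powScheme (fun i ↦ pow_ne_zero _ WittVec.resCard_ne_zero) _ α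
    fun T f f' g g' n hf hg ↦ ?_
  simp only [hα] at hf hg ⊢
  rw [MonObj.mul_comp, MonObj.mul_comp]
  exact fiberBasePts_mul_congr hπ hf hg

end DrinfeldKernel

end RamifiedWitt

end

theorem mainTheorem4 {O O' : Type u}
    [CommRing O] [IsDomain O] [IsDiscreteValuationRing O]
    [IsAdicComplete (IsLocalRing.maximalIdeal O) O] [Finite (IsLocalRing.ResidueField O)]
    [CommRing O'] [IsDomain O'] [IsDiscreteValuationRing O']
    [Finite (IsLocalRing.ResidueField O')]
    [Algebra O O'] [Module.Finite O O'] [FaithfulSMul O O'] [Algebra.Unramified O O']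
    {π : O} (hπ : Irreducible π) {ϖ : O'} (hϖ : Irreducible ϖ) {r : ℕ}
    (hr : Nat.card (IsLocalRing.ResidueField O') = Nat.card (IsLocalRing.ResidueField O) ^ r) :
    RamifiedWitt.IsUniversalHomeomorphism
        (RamifiedWitt.drinfeldSpecialFiber hπ hϖ hr).hom.hom.left ∧
      RamifiedWitt.IsProInfinitesimal
        (CategoryTheory.Limits.kernel (RamifiedWitt.drinfeldSpecialFiber hπ hϖ hr)) ∧
      Nonempty ((CategoryTheory.Limits.kernel (RamifiedWitt.drinfeldSpecialFiber hπ hϖ hr)).X ≅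
        CategoryTheory.Over.mk (AlgebraicGeometry.Spec.map (CommRingCat.ofHom
          (algebraMap (IsLocalRing.ResidueField O')
            (MvPolynomial ℕ (IsLocalRing.ResidueField O') ⧸
              Ideal.span (Set.range fun i : ℕ ↦
                (MvPolynomial.X i : MvPolynomial ℕ (IsLocalRing.ResidueField O')) ^
                  Nat.card (IsLocalRing.ResidueField O) ^ (i * (r - 1)))))))) := by
  obtain ⟨α, -⟩ := RamifiedWitt.exists_iso_kernel_drinfeldSpecialFiber hπ hϖ hr
  exact ⟨RamifiedWitt.isUniversalHomeomorphism_drinfeldSpecialFiber hπ hϖ hr,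
    RamifiedWitt.isProInfinitesimal_kernel_drinfeldSpecialFiber hπ hϖ hr, ⟨α⟩⟩
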